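/- **Theorem (dual isomorphism).** *Setting.* Let $\mathcal L$ be either the language $(\wedge,\vee,\to,0,1)$ of intuitionistic logic or the language $(\wedge,\vee,\neg,0,1,(\Diamond_i)_{i\in I})$ of modal logic, where we put $a\to b:=\neg a\vee b$, $a\leftrightarrow b:=(a\to b)\wedge(b\to a)$ and $\Box_i a:=\neg\Diamond_i\neg a$. Let $\mathsf{Prop}$ be an infinite set of propositional variables; formulas are $\mathcal L$-terms over $\mathsf{Prop}$. Let $\mathsf L$ be a superintuitionistic logic (a set of formulas that contains the intuitionistic propositional calculus and is closed under modus ponens and substitution), respectively a normal modal logic (a set of formulas that contains all classical tautologies, $\Box_i(a\to b)\to(\Box_i a\to\Box_i b)$ and $\Diamond_i a\leftrightarrow\neg\Box_i\neg a$, and is closed under modus ponens, substitution and necessitation). An *$\mathsf L$-algebra* is a Heyting algebra, respectively a modal algebra (a Boolean algebra with operations $\Diamond_i$ such that $\Diamond_i0=0$ and $\Diamond_i(x\vee y)=\Diamond_i x\vee\Diamond_i y$), in which every formula of $\mathsf L$ has the value $1$ under every valuation. *Rules.* A *$\Pi_2$-rule* $\tilde\forall\bar p\,\Gamma/^2\psi$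 is a triple $(\Gamma,\psi,F)$ of a finite set $\Gamma$ of formulas, a formula $\psi$, and a finite set $F=\{\bar p\}$ of variables ("bound" variables) that do not occur in $\psi$. A variable occurs *free* in $\Gamma$ if it occurs in $\Gamma$ and is not in $F$. An algebra $\mathcal A$ validates the rule if for every valuation $v:\mathsf{Prop}\to A$: if $v'(\phi)=1$ for all $\phi\in\Gamma$ and all valuations $v'$ that agree with $v$ outside $F$, then $v(\psi)=1$. A set $\vdash$ of $\Pi_2$-rules is a *$\Pi_2$-rule system* if it satisfies the following conditions (all triples mentioned being $\Pi_2$-rules). * Strong reflexivity: $\tilde\forall\bar p\,\Gamma\vdash\chi[\bar\phi/\bar p]$ for $\chi\in\Gamma$ and formulas $\bar\phi$ in which no variable of $\bar p$ occurs. * Monotonicity: if $\tilde\forall\bar p\,\Gamma\vdash\psi$, then $\tilde\forall\bar p\,(\Gamma\cup\Gamma')\vdash\psi$ for every finite set $\Gamma'$ of formulas. * $\alpha$-renaming: if $\tilde\forall\bar p\,\Gamma\vdash\psi$ and $\bar q$ are pairwise distinct variables, as many as $\bar p$, that do not occur free in $\Gamma$ and do not occur in $\psi$, then $\tilde\forall\bar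 q\,\Gamma[\bar q/\bar p]\vdash\psi$. * Rule cut: if $\tilde\forall\bar p\,\Gamma\vdash\mu$ for every $\mu\in\Delta$, and $\tilde\forall\bar q\,\Delta\vdash\psi$, where $\psi$ contains no variable of $\bar p$ or $\bar q$ and $\Gamma$ contains no variable of $\bar q$, then $\tilde\forall\bar p\,\Gamma\vdash\psi$. * Bound structurality: if $\tilde\forall\bar p\,\Gamma\vdash\psi$, and $\sigma$ is a substitution that fixes every variable of $\bar p$ and is such that no variable of $\bar p$ occurs in $\sigma(\psi)$, nor in $\sigma(q)$ for any variable $q$ outside $\bar p$ that occurs in $\Gamma$, $\sigma[\Gamma]$ or $\sigma(\psi)$, then $\tilde\forall\bar p\,\sigma[\Gamma]\vdash\sigma(\psi)$. It *extends $\mathsf L$* if it contains the rules $\emptyset/\phi$ for $\phi\in\mathsf L$, modus ponens $\{a,a\to b\}/b$ and, in the modal case, necessitation $\{a\}/\Box_i a$ (all without bound variables). *Classes.* A *$\forall$-embedding* $f:\mathcal A\to\mathcal B$ is an embedding such that $\mathcal A\vDash\forall\bar x\,\phi(\bar x,\bar a)$ implies $\mathcal B\vDash\forall\bar x\,\phi(\bar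 x,f(\bar a))$ for every atomic formula $\phi$ and every tuple $\bar a$ in $A$; then $\mathcal A$ is an isomorphic copy of a $\forall$-subalgebra of $\mathcal B$. An *inductive rule class* is a class of $\mathsf L$-algebras that is closed under isomorphic copies of $\forall$-subalgebras, of direct products (the empty product included) and of ultraproducts. For a class $\mathbf K$, let $\mathbb R^{\mathbb I}(\mathbf K)$ be the smallest inductive rule class that contains $\mathbf K$, and $\Pi_2(\mathbf K)$ the set of all $\Pi_2$-rules valid in every member of $\mathbf K$. For a set $S$ of $\Pi_2$-rules, let $Ind(S)$ be the class of all $\mathsf L$-algebras that validate every rule of $S$. *Claim.* The $\Pi_2$-rule systems extending $\mathsf L$ form a lattice under inclusion, with meet $S\cap T$ and join $S\vee T$ the smallest $\Pi_2$-rule system that contains $S\cup T$; the inductive rule classes of $\mathsf L$-algebras form a lattice under inclusion, with meet $\mathbf K\cap\mathbf M$ and join $\mathbb R^{\mathbb I}(\mathbf K\cup\mathbf M)$. The map $Ind$ is an order-reversing bijection (a dual isomorphism, reversing the order in both directions) from the first lattice onto the second, with inverse $\Pi_2$. In particular, for all $\Pi_2$-rule systems $S,T$ extending $\mathsf L$,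 $$Ind(S\cap T)=\mathbb R^{\mathbb I}(Ind(S)\cup Ind(T)),\qquad Ind(S\vee T)=Ind(S)\cap Ind(T).$$ -/

import Mathlib

open FirstOrder

universe u

namespace PiTwo

/-! ### General syntax: `Π₂`-rules over an algebraic language -/

section Rules

variable {ℒ : FirstOrder.Language.{u, 0}} {V : Type u}

/-- The set of variables occurring in a formula. A propositional formula of an algebraic language
is a term over the set `V` of propositional variables. -/
def vars (φ : ℒ.Term V) : Set V :=
  letI := Classical.decEq V
  ↑φ.varFinset

/-- The set of variables occurring in some formula of `Γ`. -/
def varsOf (Γ : Set (ℒ.Term V)) : Set V := ⋃ φ ∈ Γ, vars φ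

/-- `σ[Γ] = {σ(φ) : φ ∈ Γ}`. -/
def substSet (σ : V → ℒ.Term V) (Γ : Set (ℒ.Term V)) : Set (ℒ.Term V) :=
  (fun φ => φ.subst σ) '' Γ

variable (ℒ V) in
/-- A `Π₂`-rule `(Γ, ψ, F)`: a finite set `Γ` of premises, a conclusion `ψ`, and a finite set `F`
of (bound) variables, none of which occurs in `ψ`. -/
@[ext]
structure Pi2Rule where
  prem : Set (ℒ.Term V)
  concl : ℒ.Term V
  bound : Set V
  prem_finite : prem.Finite
  bound_finite : bound.Finite
  bound_concl : Disjoint bound (vars concl)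

/-- A `Π₁`-rule `Γ ⊢ ψ`, i.e. a `Π₂`-rule without bound variables. -/
def pi1Rule (Γ : Set (ℒ.Term V)) (hΓ : Γ.Finite) (ψ : ℒ.Term V) : Pi2Rule ℒ V :=
  ⟨Γ, ψ, ∅, hΓ, Set.finite_empty, Set.empty_disjoint _⟩

/-- The closure conditions that define a `Π₂`-rule system. In each of them the rule `r`, being a
`Π₂`-rule, satisfies `Disjoint r.bound (vars r.concl)`. -/
structure IsPi2RuleSystem (S : Set (Pi2Rule ℒ V)) : Prop where
  /-- Strong reflexivity: `∀p̄ Γ ⊢ χ[φ̄/p̄]` for `χ ∈ Γ`, if no variable of `p̄` occurs in `φ̄`. -/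
  strong_reflexivity : ∀ (r : Pi2Rule ℒ V) (χ : ℒ.Term V) (σ : V → ℒ.Term V),
    χ ∈ r.prem →
    (∀ p ∉ r.bound, σ p = .var p) →
    (∀ p ∈ r.bound, Disjoint r.bound (vars (σ p))) →
    r.concl = χ.subst σ → r ∈ S
  /-- Monotonicity: from `∀p̄ Γ ⊢ ψ` to `∀p̄ (Γ, Γ') ⊢ ψ`. -/
  monotonicity : ∀ (r₀ r : Pi2Rule ℒ V), r₀ ∈ S →
    r₀.prem ⊆ r.prem → r.bound = r₀.bound → r.concl = r₀.concl → r ∈ S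
  /-- `α`-renaming: from `∀p̄ Γ ⊢ ψ` to `∀q̄ Γ[q̄/p̄] ⊢ ψ`, if the `qᵢ` are distinct and do not occur
  free in `Γ` or `ψ`. -/
  alpha_renaming : ∀ (r₀ r : Pi2Rule ℒ V) (ρ : V → V), r₀ ∈ S →
    Set.InjOn ρ r₀.bound →
    (∀ p ∉ r₀.bound, ρ p = p) →
    Disjoint (ρ '' r₀.bound) (varsOf r₀.prem \ r₀.bound) →
    Disjoint (ρ '' r₀.bound) (vars r₀.concl) →
    r.prem = substSet (fun p => .var (ρ p)) r₀.prem →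
    r.bound = ρ '' r₀.bound → r.concl = r₀.concl → r ∈ S
  /-- Rule cut: from `∀p̄ Γ ⊢ μ` for all `μ ∈ Δ` and `∀q̄ Δ ⊢ ψ` to `∀p̄ Γ ⊢ ψ`, if no variable of
  `q̄` occurs in `Γ` (and `ψ` contains no variable of `p̄` or `q̄`). -/
  rule_cut : ∀ (d r : Pi2Rule ℒ V), d ∈ S →
    (∀ μ ∈ d.prem, ∃ g ∈ S, g.prem = r.prem ∧ g.bound = r.bound ∧ g.concl = μ) →
    Disjoint d.bound (varsOf r.prem) →
    r.concl = d.concl → r ∈ S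
  /-- Bound structurality: from `∀p̄ Γ ⊢ ψ` to `∀p̄ σ[Γ] ⊢ σ(ψ)`, if `σ` fixes `p̄` and no variable
  of `p̄` occurs in `σ(q)` for `q` free in `Γ`, `σ[Γ]` or `σ(ψ)`. -/
  bound_structurality : ∀ (r₀ r : Pi2Rule ℒ V) (σ : V → ℒ.Term V), r₀ ∈ S →
    (∀ p ∈ r₀.bound, σ p = .var p) →
    (∀ q ∈ (varsOf r₀.prem ∪ varsOf (substSet σ r₀.prem) ∪ vars (r₀.concl.subst σ)) \ r₀.bound,
      Disjoint r₀.bound (vars (σ q))) →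
    r.prem = substSet σ r₀.prem →
    r.bound = r₀.bound → r.concl = r₀.concl.subst σ → r ∈ S

/-- `ruleClosure B` is the smallest `Π₂`-rule system that contains the set of rules `B`. -/
def ruleClosure (B : Set (Pi2Rule ℒ V)) : Set (Pi2Rule ℒ V) :=
  ⋂₀ {S | IsPi2RuleSystem S ∧ B ⊆ S}

theorem isPi2RuleSystem_sInter {𝒮 : Set (Set (Pi2Rule ℒ V))}
    (h : ∀ S ∈ 𝒮, IsPi2RuleSystem S) : IsPi2RuleSystem (⋂₀ 𝒮) where
  strong_reflexivity r χ σ h₁ h₂ h₃ h₄ S hS := (h S hS).strong_reflexivity r χ σ h₁ h₂ h₃ h₄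
  monotonicity r₀ r h₀ h₁ h₂ h₃ S hS := (h S hS).monotonicity r₀ r (h₀ S hS) h₁ h₂ h₃
  alpha_renaming r₀ r ρ h₀ h₁ h₂ h₃ h₄ h₅ h₆ h₇ S hS :=
    (h S hS).alpha_renaming r₀ r ρ (h₀ S hS) h₁ h₂ h₃ h₄ h₅ h₆ h₇
  rule_cut d r h₀ h₁ h₂ h₃ S hS := (h S hS).rule_cut d r (h₀ S hS)
    (fun μ hμ => (h₁ μ hμ).imp fun _ hg => ⟨hg.1 S hS, hg.2⟩) h₂ h₃
  bound_structurality r₀ r σ h₀ h₁ h₂ h₃ h₄ h₅ S hS :=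
    (h S hS).bound_structurality r₀ r σ (h₀ S hS) h₁ h₂ h₃ h₄ h₅

theorem isPi2RuleSystem_ruleClosure (B : Set (Pi2Rule ℒ V)) : IsPi2RuleSystem (ruleClosure B) :=
  isPi2RuleSystem_sInter fun _ hS => hS.1

theorem isPi2RuleSystem_inter {S T : Set (Pi2Rule ℒ V)} (hS : IsPi2RuleSystem S)
    (hT : IsPi2RuleSystem T) : IsPi2RuleSystem (S ∩ T) := by
  rw [← Set.sInter_pair]
  exact isPi2RuleSystem_sInter (by rintro _ (rfl | rfl) <;> assumption)

theorem subset_ruleClosure (B : Set (Pi2Rule ℒ V)) : B ⊆ ruleClosure B :=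
  fun _ hr _ hS => hS.2 hr

theorem ruleClosure_subset {B S : Set (Pi2Rule ℒ V)} (hS : IsPi2RuleSystem S) (h : B ⊆ S) :
    ruleClosure B ⊆ S :=
  fun _ hr => hr S ⟨hS, h⟩

end Rules

/-! ### General algebra -/

section Algebra

variable {ℒ : FirstOrder.Language.{u, 0}}

/-- `f : A → B` is a `∀`-embedding: an embedding such that `A ⊨ ∀x̄ φ(x̄, ā)` implies
`B ⊨ ∀x̄ φ(x̄, f(ā))` for every atomic formula `φ` and every tuple `ā` in `A`. -/
def IsForallEmbedding {A B : Type u} [ℒ.Structure A] [ℒ.Structure B] (f : A ↪[ℒ] B) : Prop :=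
  ∀ (m n : ℕ) (φ : ℒ.Formula (Fin m ⊕ Fin n)), φ.IsAtomic → ∀ a : Fin n → A,
    (∀ x : Fin m → A, φ.Realize (Sum.elim x a)) →
      ∀ x : Fin m → B, φ.Realize (Sum.elim x (f ∘ a))

/-- The direct product of a family of structures. -/
instance piStructure {I : Type u} (M : I → Type u) [∀ i, ℒ.Structure (M i)] :
    ℒ.Structure (∀ i, M i) where
  funMap f x i := FirstOrder.Language.Structure.funMap f fun j => x j i
  RelMap R x := ∀ i, FirstOrder.Language.Structure.RelMap R fun j => x j i

end Algebra

/-! ### The languages of intuitionistic logic and of modal logic -/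

/-- The connectives `0, 1, ∧, ∨, →` of intuitionistic logic. -/
inductive IntConn : ℕ → Type u
  | bot : IntConn 0
  | top : IntConn 0
  | and : IntConn 2
  | or : IntConn 2
  | imp : IntConn 2

/-- The connectives `0, 1, ¬, ∧, ∨` and the modalities `◇ᵢ`, for `i : ι`, of modal logic. -/
inductive ModConn (ι : Type u) : ℕ → Type u
  | bot : ModConn ι 0
  | top : ModConn ι 0
  | neg : ModConn ι 1
  | dia (i : ι) : ModConn ι 1
  | and : ModConn ι 2
  | or : ModConn ι 2

/-- The language of intuitionistic logic and of Heyting algebras. -/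
def intLang : FirstOrder.Language.{u, 0} := ⟨IntConn, fun _ => Empty⟩

/-- The language of modal logic and of modal algebras. -/
def modLang (ι : Type u) : FirstOrder.Language.{u, 0} := ⟨ModConn ι, fun _ => Empty⟩

namespace IntL

variable {V : Type u}

def bot : intLang.Term V := .func (l := 0) IntConn.bot ![]
def top : intLang.Term V := .func (l := 0) IntConn.top ![]
def and (a b : intLang.Term V) : intLang.Term V := .func (l := 2) IntConn.and ![a, b]
def or (a b : intLang.Term V) : intLang.Term V := .func (l := 2) IntConn.or ![a, b]
def imp (a b : intLang.Term V) : intLang.Term V := .func (l := 2) IntConn.imp ![a, b]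

/-- The axioms of a Hilbert calculus of the intuitionistic propositional calculus. -/
inductive IPCAxiom : intLang.Term V → Prop
  | verum : IPCAxiom top
  | weaken (a b) : IPCAxiom (imp a (imp b a))
  | distrib (a b c) : IPCAxiom (imp (imp a (imp b c)) (imp (imp a b) (imp a c)))
  | and_left (a b) : IPCAxiom (imp (and a b) a)
  | and_right (a b) : IPCAxiom (imp (and a b) b)
  | and_intro (a b) : IPCAxiom (imp a (imp b (and a b)))
  | or_left (a b) : IPCAxiom (imp a (or a b))
  | or_right (a b) : IPCAxiom (imp b (or a b))
  | or_elim (a b c) : IPCAxiom (imp (imp a c) (imp (imp b c) (imp (or a b) c)))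
  | falsum (a) : IPCAxiom (imp bot a)

/-- `L` is a (super)intuitionistic logic: a set of formulas that contains the intuitionistic
propositional calculus and is closed under modus ponens and substitution. -/
structure IsLogic (L : Set (intLang.Term V)) : Prop where
  ipc : ∀ a, IPCAxiom a → a ∈ L
  mp : ∀ a b, imp a b ∈ L → a ∈ L → b ∈ L
  subst : ∀ a ∈ L, ∀ σ : V → intLang.Term V, a.subst σ ∈ L

/-- The logic `L` as a collection of `Π₁`-rules: its theorems, as axioms, and modus ponens. -/
inductive Rules (L : Set (intLang.Term V)) : Pi2Rule intLang V → Prop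
  | thm (a) (ha : a ∈ L) : Rules L (pi1Rule ∅ Set.finite_empty a)
  | mp (a b) : Rules L (pi1Rule {a, imp a b} (Set.toFinite _) b)

/-- `A` is a Heyting algebra, the connectives being interpreted by its operations. -/
def IsAlgebra (A : Type u) [intLang.Structure A] : Prop :=
  ∃ _ : HeytingAlgebra A,
    FirstOrder.Language.Structure.funMap (L := intLang) (n := 0) IntConn.bot ![] = (⊥ : A) ∧
    FirstOrder.Language.Structure.funMap (L := intLang) (n := 0) IntConn.top ![] = (⊤ : A) ∧
    (∀ x y : A, FirstOrder.Language.Structure.funMap (L := intLang) (n := 2) IntConn.and ![x, y] = x ⊓ y) ∧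
    (∀ x y : A, FirstOrder.Language.Structure.funMap (L := intLang) (n := 2) IntConn.or ![x, y] = x ⊔ y) ∧
    (∀ x y : A, FirstOrder.Language.Structure.funMap (L := intLang) (n := 2) IntConn.imp ![x, y] = x ⇨ y)

end IntL

namespace ModL

variable {ι V : Type u}

def bot : (modLang ι).Term V := .func (l := 0) ModConn.bot ![]
def top : (modLang ι).Term V := .func (l := 0) ModConn.top ![]
def neg (a : (modLang ι).Term V) : (modLang ι).Term V := .func (l := 1) ModConn.neg ![a]
def dia (i : ι) (a : (modLang ι).Term V) : (modLang ι).Term V :=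
  .func (l := 1) (ModConn.dia i) ![a]
def and (a b : (modLang ι).Term V) : (modLang ι).Term V := .func (l := 2) ModConn.and ![a, b]
def or (a b : (modLang ι).Term V) : (modLang ι).Term V := .func (l := 2) ModConn.or ![a, b]
def imp (a b : (modLang ι).Term V) : (modLang ι).Term V := or (neg a) b
def iff (a b : (modLang ι).Term V) : (modLang ι).Term V := and (imp a b) (imp b a)
def box (i : ι) (a : (modLang ι).Term V) : (modLang ι).Term V := neg (dia i (neg a))

/-- `a` is an instance of a classical tautology: it is true under every assignment of truth values
to formulas that respects the Boolean connectives. -/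
def IsTautology (a : (modLang ι).Term V) : Prop :=
  ∀ w : (modLang ι).Term V → Prop,
    (w bot ↔ False) → (w top ↔ True) → (∀ b, w (neg b) ↔ ¬ w b) →
    (∀ b c, w (and b c) ↔ w b ∧ w c) → (∀ b c, w (or b c) ↔ w b ∨ w c) → w a

/-- `L` is a normal modal logic: a set of formulas that contains the tautologies, the axioms
`□(a → b) → (□a → □b)` and `◇a ↔ ¬□¬a`, and is closed under modus ponens, substitution and
necessitation. -/
structure IsLogic (L : Set ((modLang ι).Term V)) : Prop where
  taut : ∀ a, IsTautology a → a ∈ L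
  normal : ∀ i a b, imp (box i (imp a b)) (imp (box i a) (box i b)) ∈ L
  dual : ∀ i a, iff (dia i a) (neg (box i (neg a))) ∈ L
  mp : ∀ a b, imp a b ∈ L → a ∈ L → b ∈ L
  nec : ∀ i, ∀ a ∈ L, box i a ∈ L
  subst : ∀ a ∈ L, ∀ σ : V → (modLang ι).Term V, a.subst σ ∈ L

/-- The logic `L` as a collection of `Π₁`-rules: its theorems, as axioms, modus ponens and
necessitation. -/
inductive Rules (L : Set ((modLang ι).Term V)) : Pi2Rule (modLang ι) V → Prop
  | thm (a) (ha : a ∈ L) : Rules L (pi1Rule ∅ Set.finite_empty a)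
  | mp (a b) : Rules L (pi1Rule {a, imp a b} (Set.toFinite _) b)
  | nec (i a) : Rules L (pi1Rule {a} (Set.toFinite _) (box i a))

/-- The operation `◇ᵢ` of a structure for the language of modal logic. -/
def diaMap {A : Type u} [(modLang ι).Structure A] (i : ι) (x : A) : A :=
  FirstOrder.Language.Structure.funMap (L := modLang ι) (n := 1) (ModConn.dia i) ![x]

/-- `A` is a modal algebra: a Boolean algebra, the Boolean connectives being interpreted by its
operations, with operations `◇ᵢ` such that `◇ᵢ 0 = 0` and `◇ᵢ(x ∨ y) = ◇ᵢx ∨ ◇ᵢy`. -/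
def IsAlgebra (A : Type u) [(modLang ι).Structure A] : Prop :=
  ∃ _ : BooleanAlgebra A,
    FirstOrder.Language.Structure.funMap (L := modLang ι) (n := 0) ModConn.bot ![] = (⊥ : A) ∧
    FirstOrder.Language.Structure.funMap (L := modLang ι) (n := 0) ModConn.top ![] = (⊤ : A) ∧
    (∀ x : A, FirstOrder.Language.Structure.funMap (L := modLang ι) (n := 1) ModConn.neg ![x] = xᶜ) ∧
    (∀ x y : A, FirstOrder.Language.Structure.funMap (L := modLang ι) (n := 2) ModConn.and ![x, y] = x ⊓ y) ∧
    (∀ x y : A, FirstOrder.Language.Structure.funMap (L := modLang ι) (n := 2) ModConn.or ![x, y] = x ⊔ y) ∧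
    (∀ i : ι, diaMap i (⊥ : A) = ⊥) ∧
    (∀ (i : ι) (x y : A), diaMap i (x ⊔ y) = diaMap i x ⊔ diaMap i y)

end ModL

/-- The two kinds of logical systems: intuitionistic logics, and normal modal logics with
modalities indexed by `ι`. -/
inductive Kind : Type (u + 1)
  | intuitionistic : Kind
  | modal (ι : Type u) : Kind

namespace Kind

/-- The language of the logical system. -/
def lang : Kind.{u} → FirstOrder.Language.{u, 0}
  | intuitionistic => intLang
  | modal ι => modLang ι

/-- The constant `1`. -/
def one : (k : Kind.{u}) → k.lang.Constants
  | intuitionistic => IntConn.top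
  | modal _ => ModConn.top

/-- The (super)intuitionistic logics, respectively the normal modal logics. -/
def IsLogic {V : Type u} : (k : Kind.{u}) → Set (k.lang.Term V) → Prop
  | intuitionistic => IntL.IsLogic
  | modal _ => ModL.IsLogic

/-- A logic as a collection of `Π₁`-rules. -/
def rules {V : Type u} : (k : Kind.{u}) → Set (k.lang.Term V) → Set (Pi2Rule k.lang V)
  | intuitionistic => fun L => {r | IntL.Rules L r}
  | modal _ => fun L => {r | ModL.Rules L r}

/-- Heyting algebras, respectively modal algebras. -/
def IsAlgebra : (k : Kind.{u}) → (A : Type u) → k.lang.Structure A → Prop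
  | intuitionistic => fun A s => @IntL.IsAlgebra A s
  | modal ι => fun A s => @ModL.IsAlgebra ι A s

end Kind

/-! ### Validity, the algebras of a logic, and the two lattices -/

section Main

variable {k : Kind.{u}} {V : Type u}

/-- The formula `φ` takes the value `1` in `A` under the valuation `v`. -/
def TrueAt {A : Type u} [k.lang.Structure A] (v : V → A) (φ : k.lang.Term V) : Prop :=
  φ.realize v = (k.one : A)

/-- `A ⊨ Γ/²ψ`: for each valuation `v`, if every valuation `v'` that agrees with `v` outside the
bound variables makes all premises true, then `v` makes the conclusion true. -/
def Validates (A : Type u) [k.lang.Structure A] (r : Pi2Rule k.lang V) : Prop :=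
  ∀ v : V → A, (∀ φ ∈ r.prem, ∀ v' : V → A, (∀ p ∉ r.bound, v' p = v p) → TrueAt v' φ) →
    TrueAt v r.concl

/-- The algebras of the logic `L`: the Heyting (or modal) algebras in which every formula of `L`
takes the value `1` under every valuation. -/
structure LAlgebra (L : Set (k.lang.Term V)) : Type (u + 1) where
  carrier : Type u
  [str : k.lang.Structure carrier]
  isAlgebra : k.IsAlgebra carrier str
  models : ∀ φ ∈ L, ∀ v : V → carrier, TrueAt v φ

attribute [instance] LAlgebra.str

variable {L : Set (k.lang.Term V)}

/-- A class of `L`-algebras is an inductive rule class if it is closed under isomorphic copies of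
`∀`-subalgebras, of direct products (of arbitrary, possibly empty, families) and of
ultraproducts. -/
structure IsInductiveRuleClass (K : Set (LAlgebra L)) : Prop where
  forall_sub : ∀ (A B : LAlgebra L) (f : A.carrier ↪[k.lang] B.carrier),
    IsForallEmbedding f → B ∈ K → A ∈ K
  prod : ∀ (I : Type u) (B : I → LAlgebra L) (A : LAlgebra L), (∀ i, B i ∈ K) →
    Nonempty (A.carrier ≃[k.lang] (∀ i, (B i).carrier)) → A ∈ K
  ultraprod : ∀ (I : Type u) (U : Ultrafilter I) (B : I → LAlgebra L) (A : LAlgebra L),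
    (∀ i, B i ∈ K) →
    Nonempty (A.carrier ≃[k.lang] (U : Filter I).Product fun i => (B i).carrier) → A ∈ K

/-- The smallest inductive rule class that contains the class `K`. -/
def inductiveClosure (K : Set (LAlgebra L)) : Set (LAlgebra L) :=
  ⋂₀ {C | IsInductiveRuleClass C ∧ K ⊆ C}

theorem isInductiveRuleClass_sInter {𝒞 : Set (Set (LAlgebra L))}
    (h : ∀ C ∈ 𝒞, IsInductiveRuleClass C) : IsInductiveRuleClass (⋂₀ 𝒞) where
  forall_sub A B f hf hB C hC := (h C hC).forall_sub A B f hf (hB C hC)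
  prod I B A hB hA C hC := (h C hC).prod I B A (fun i => hB i C hC) hA
  ultraprod I U B A hB hA C hC := (h C hC).ultraprod I U B A (fun i => hB i C hC) hA

theorem isInductiveRuleClass_inductiveClosure (K : Set (LAlgebra L)) :
    IsInductiveRuleClass (inductiveClosure K) :=
  isInductiveRuleClass_sInter fun _ hC => hC.1

theorem isInductiveRuleClass_inter {C D : Set (LAlgebra L)} (hC : IsInductiveRuleClass C)
    (hD : IsInductiveRuleClass D) : IsInductiveRuleClass (C ∩ D) := by
  rw [← Set.sInter_pair]
  exact isInductiveRuleClass_sInter (by rintro _ (rfl | rfl) <;> assumption)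

theorem subset_inductiveClosure (K : Set (LAlgebra L)) : K ⊆ inductiveClosure K :=
  fun _ hA _ hC => hC.2 hA

theorem inductiveClosure_subset {K C : Set (LAlgebra L)} (hC : IsInductiveRuleClass C)
    (h : K ⊆ C) : inductiveClosure K ⊆ C :=
  fun _ hA => hA C ⟨hC, h⟩

/-- The `Π₂`-rules valid in all algebras of the class `K`. -/
def pi2 (K : Set (LAlgebra L)) : Set (Pi2Rule k.lang V) :=
  {r | ∀ A ∈ K, Validates A.carrier r}

/-- The class of all `L`-algebras that validate all rules of `S`. -/
def ind (L : Set (k.lang.Term V)) (S : Set (Pi2Rule k.lang V)) : Set (LAlgebra L) :=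
  {A | ∀ r ∈ S, Validates A.carrier r}

/-- The `Π₂`-rule systems that extend the logic `L`, ordered by inclusion. -/
def RuleSystem (L : Set (k.lang.Term V)) : Type u :=
  {S : Set (Pi2Rule k.lang V) // IsPi2RuleSystem S ∧ k.rules L ⊆ S}

/-- The inductive rule classes of `L`-algebras, ordered by inclusion. -/
def InductiveRuleClass (L : Set (k.lang.Term V)) : Type (u + 1) :=
  {K : Set (LAlgebra L) // IsInductiveRuleClass K}

/-- The lattice of `Π₂`-rule systems extending `L`: the meet is the intersection, the join of `S`
and `T` is the smallest `Π₂`-rule system that contains `S ∪ T`. -/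
instance : Lattice (RuleSystem L) where
  le S T := S.1 ⊆ T.1
  le_refl _ := subset_rfl
  le_trans _ _ _ h₁ h₂ := h₁.trans h₂
  le_antisymm _ _ h₁ h₂ := Subtype.ext (h₁.antisymm h₂)
  inf S T := ⟨S.1 ∩ T.1, isPi2RuleSystem_inter S.2.1 T.2.1, Set.subset_inter S.2.2 T.2.2⟩
  inf_le_left _ _ := Set.inter_subset_left
  inf_le_right _ _ := Set.inter_subset_right
  le_inf _ _ _ h₁ h₂ := Set.subset_inter h₁ h₂
  sup S T := ⟨ruleClosure (S.1 ∪ T.1), isPi2RuleSystem_ruleClosure _,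
    S.2.2.trans (Set.subset_union_left.trans (subset_ruleClosure _))⟩
  le_sup_left _ _ := Set.subset_union_left.trans (subset_ruleClosure _)
  le_sup_right _ _ := Set.subset_union_right.trans (subset_ruleClosure _)
  sup_le _ _ U h₁ h₂ := ruleClosure_subset U.2.1 (Set.union_subset h₁ h₂)

/-- The lattice of inductive rule classes of `L`-algebras: the meet is the intersection, the join
of `K` and `M` is the smallest inductive rule class that contains `K ∪ M`. -/
instance : Lattice (InductiveRuleClass L) where
  le K M := K.1 ⊆ M.1
  le_refl _ := subset_rfl
  le_trans _ _ _ h₁ h₂ := h₁.trans h₂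
  le_antisymm _ _ h₁ h₂ := Subtype.ext (h₁.antisymm h₂)
  inf K M := ⟨K.1 ∩ M.1, isInductiveRuleClass_inter K.2 M.2⟩
  inf_le_left _ _ := Set.inter_subset_left
  inf_le_right _ _ := Set.inter_subset_right
  le_inf _ _ _ h₁ h₂ := Set.subset_inter h₁ h₂
  sup K M := ⟨inductiveClosure (K.1 ∪ M.1), isInductiveRuleClass_inductiveClosure _⟩
  le_sup_left _ _ := Set.subset_union_left.trans (subset_inductiveClosure _)
  le_sup_right _ _ := Set.subset_union_right.trans (subset_inductiveClosure _)
  sup_le _ _ U h₁ h₂ := inductiveClosure_subset U.2 (Set.union_subset h₁ h₂)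

end Main

end PiTwo

namespace PiTwo

/-! ### Occurrence of variables, substitution and realization -/

section Occurrence

variable {ℒ : FirstOrder.Language.{u, 0}} {V : Type u}

/-! `ind` and `pi2` form a Galois connection, so the theorem reduces to two soundness facts and two
fixed-point equations. Soundness: validity in one algebra respects the closure conditions on rules
(`isPi2RuleSystem_validates`), and validity of a rule passes to `∀`-subalgebras, products and
ultraproducts (`isInductiveRuleClass_ind`).

The equation `pi2 (ind L S) = S` is completeness (`exists_mem_ind_not_validates`). For a rule `∀F Γ
/ ψ` outside `S`, let `T` consist of the `φ` such that `∀F Γ ⊢ φ[1/F]` is in `S`. Valuations in the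
Lindenbaum–Tarski algebra of `T` are substitutions, so quantifying over values of bound variables
means quantifying over formulas. Strong reflexivity puts every instance of `Γ` with formulas for `F`
into `T`. Renaming, bound structurality and rule cut make `T` closed under `S` in this strong sense
(`concl_subst_mem_derivedTheory`). The algebra therefore validates `S`, while `ψ ∉ T`.

The equation `ind L (pi2 K) = K` is a diagram argument (`ind_pi2_subset`). Let `A` validate `pi2 K`.
Finitely many universal equations with parameters true in `A`, together with an element `a ≠ 1`,
form a rule that fails in `A`, hence in a member of `K`. The parameters are its free variables, the
quantified variables its bound ones, and the name of `a` its conclusion. A product over all `a ≠ 1`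
and an ultraproduct over the finite sets of equations yield a member of `K` into which `A` has a
`∀`-embedding. Equations reduce to formulas with value `1` through the biconditional.

Infinitely many variables are needed to rename bound variables apart and to name any finite set of
parameters. -/

theorem vars_var (p : V) : vars (.var p : ℒ.Term V) = {p} := by
  simp [vars, FirstOrder.Language.Term.varFinset]

theorem mem_vars_func {n : ℕ} {f : ℒ.Functions n} {ts : Fin n → ℒ.Term V} {p : V} :
    p ∈ vars (.func f ts) ↔ ∃ i, p ∈ vars (ts i) := by
  simp [vars, FirstOrder.Language.Term.varFinset]

theorem finite_vars (φ : ℒ.Term V) : (vars φ).Finite := by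
  classical
  exact Finset.finite_toSet _

theorem mem_varsOf {Γ : Set (ℒ.Term V)} {p : V} : p ∈ varsOf Γ ↔ ∃ φ ∈ Γ, p ∈ vars φ := by
  simp [varsOf]

theorem finite_varsOf {Γ : Set (ℒ.Term V)} (hΓ : Γ.Finite) : (varsOf Γ).Finite :=
  hΓ.biUnion fun φ _ => finite_vars φ

theorem vars_subset_varsOf {Γ : Set (ℒ.Term V)} {φ : ℒ.Term V} (h : φ ∈ Γ) :
    vars φ ⊆ varsOf Γ :=
  fun _ hp => mem_varsOf.2 ⟨φ, h, hp⟩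

theorem realize_congr {A : Type*} [ℒ.Structure A] {φ : ℒ.Term V} {v w : V → A}
    (h : ∀ p ∈ vars φ, v p = w p) : φ.realize v = φ.realize w := by
  induction φ with
  | var p => exact h p (by simp [vars_var])
  | func f ts ih =>
    simp only [FirstOrder.Language.Term.realize]
    congr 1
    funext i
    exact ih i fun p hp => h p (mem_vars_func.2 ⟨i, hp⟩)

theorem subst_congr {W : Type u} {φ : ℒ.Term V} {σ τ : V → ℒ.Term W}
    (h : ∀ p ∈ vars φ, σ p = τ p) : φ.subst σ = φ.subst τ := by
  induction φ with
  | var p => exact h p (by simp [vars_var])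
  | func f ts ih =>
    simp only [FirstOrder.Language.Term.subst]
    congr 1
    funext i
    exact ih i fun p hp => h p (mem_vars_func.2 ⟨i, hp⟩)

theorem subst_var (φ : ℒ.Term V) : φ.subst .var = φ := by
  induction φ with
  | var p => rfl
  | func f ts ih => simp only [FirstOrder.Language.Term.subst, ih]

theorem subst_eq_self {φ : ℒ.Term V} {σ : V → ℒ.Term V} (h : ∀ p ∈ vars φ, σ p = .var p) :
    φ.subst σ = φ :=
  (subst_congr h).trans (subst_var φ)

theorem subst_subst (φ : ℒ.Term V) (σ τ : V → ℒ.Term V) :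
    (φ.subst σ).subst τ = φ.subst fun p => (σ p).subst τ := by
  induction φ with
  | var p => rfl
  | func f ts ih => simp only [FirstOrder.Language.Term.subst, ih]

theorem mem_vars_subst {φ : ℒ.Term V} {σ : V → ℒ.Term V} {q : V} :
    q ∈ vars (φ.subst σ) ↔ ∃ p ∈ vars φ, q ∈ vars (σ p) := by
  induction φ with
  | var p => simp [vars_var, FirstOrder.Language.Term.subst]
  | func f ts ih =>
    simp only [FirstOrder.Language.Term.subst, mem_vars_func, ih]
    exact ⟨fun ⟨i, p, hp, hq⟩ => ⟨p, ⟨i, hp⟩, hq⟩, fun ⟨p, ⟨i, hp⟩, hq⟩ => ⟨i, p, hp, hq⟩⟩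

/-- The value of a term in a direct product is computed coordinatewise. -/
theorem realize_pi {α : Type*} {I : Type u} (M : I → Type u) [∀ i, ℒ.Structure (M i)]
    (t : ℒ.Term α) (v : α → ∀ i, M i) (i : I) :
    t.realize v i = t.realize fun p => v p i := by
  induction t with
  | var => rfl
  | func f ts ih =>
    simp only [FirstOrder.Language.Term.realize, ← ih]
    rfl

theorem exists_injOn_fin {α : Type*} {F : Set α} (hF : F.Finite) :
    ∃ (n : ℕ) (g : α → Fin n), Set.InjOn g F := by
  classical
  obtain ⟨n, ⟨e⟩⟩ := hF.exists_equiv_fin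
  -- The extra element is the value outside `F`; it keeps the map total when `F` is empty.
  refine ⟨n + 1, fun p => if h : p ∈ F then (e ⟨p, h⟩).castSucc else Fin.last n, ?_⟩
  intro p hp q hq h
  simpa [hp, hq] using h

/-- Supplies fresh variables: bound variables are renamed away from a finite set `X`, and finitely
many parameters receive distinct names. -/
theorem exists_injOn_of_infinite {α β : Type*} [Infinite β] {F : Set α} (hF : F.Finite)
    {X : Set β} (hX : X.Finite) :
    ∃ g : α → β, Set.InjOn g F ∧ ∀ p, g p ∉ X := by
  obtain ⟨n, g, hg⟩ := exists_injOn_fin hF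
  have : Infinite (Xᶜ : Set β) := hX.infinite_compl.to_subtype
  let e : ℕ ↪ (Xᶜ : Set β) := Infinite.natEmbedding _
  refine ⟨fun p => (e (g p).val).1, fun p hp q hq h => hg hp hq ?_, fun p => (e _).2⟩
  exact Fin.ext (e.injective (Subtype.ext h))

/-- Turns facts about formulas in at most three variables into laws for arbitrary elements. -/
theorem exists_valuation (V : Type*) [Infinite V] {A : Type*} (a b c : A) :
    ∃ (v : V → A) (p q r : V), v p = a ∧ v q = b ∧ v r = c := by
  classical
  let e := Infinite.natEmbedding V
  exact ⟨fun x => if x = e 0 then a else if x = e 1 then b else c, e 0, e 1, e 2, by simp⟩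

end Occurrence

/-! ### Soundness -/

section Soundness

variable {k : Kind.{u}} {V : Type u}

/-- Each condition is a change of valuation. The side conditions on variables ensure that the
changed valuation differs from the given one only at bound variables and gives the formulas the
intended values. -/
theorem isPi2RuleSystem_validates (A : Type u) [k.lang.Structure A] :
    IsPi2RuleSystem {r : Pi2Rule k.lang V | Validates A r} where
  strong_reflexivity r χ σ hχ hσ _ hr v hv := by
    have := hv χ hχ (fun p => (σ p).realize v) fun p hp => by rw [hσ p hp]; rfl
    rw [hr, TrueAt, FirstOrder.Language.Term.realize_subst]
    exact this
  monotonicity r₀ r h₀ h₁ h₂ h₃ v hv := by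
    rw [h₃]
    exact h₀ v fun φ hφ v' hv' => hv φ (h₁ hφ) v' (by rwa [h₂])
  alpha_renaming r₀ r ρ h₀ hρ hρ' hd₁ _ hp hb hc v hv := by
    classical
    rw [hc]
    refine h₀ v fun φ hφ w hw => ?_
    -- The value of `w` at a bound `p` is moved to `ρ p`; outside the new bound variables the
    -- valuation is `v`.
    have key := hv (φ.subst fun p => .var (ρ p)) (by rw [hp]; exact ⟨φ, hφ, rfl⟩)
      (Function.extend (fun p : r₀.bound => ρ p) (fun p => w p) v)
      fun p hp' => Function.extend_apply' _ _ _ fun ⟨q, hq⟩ => hp' (hb ▸ ⟨q, q.2, hq⟩)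
    rw [TrueAt, FirstOrder.Language.Term.realize_subst] at key
    rw [TrueAt, ← key]
    refine realize_congr fun p hpφ => ?_
    simp only [FirstOrder.Language.Term.realize]
    by_cases hpb : p ∈ r₀.bound
    · exact (hρ.injective.extend_apply (fun p : r₀.bound => w p) v ⟨p, hpb⟩).symm
    · rw [hρ' p hpb, Function.extend_apply', hw p hpb]
      exact fun ⟨q, hq⟩ => Set.disjoint_left.1 hd₁ ⟨q, q.2, hq⟩ ⟨vars_subset_varsOf hφ hpφ, hpb⟩
  rule_cut d r hd hg hdisj hc v hv := by
    classical
    rw [hc]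
    refine hd v fun μ hμ v' hv' => ?_
    obtain ⟨g, hgS, hgp, hgb, rfl⟩ := hg μ hμ
    refine hgS v' fun φ hφ v'' hv'' => ?_
    rw [hgp] at hφ
    rw [hgb] at hv''
    -- Off `r.bound`, `v''` and `v` can differ only on `d.bound`, which does not meet `Γ`. So this
    -- mixed valuation, an admissible variant of `v`, agrees with `v''` on `Γ`.
    have key := hv φ hφ (fun p => if p ∈ r.bound then v'' p else v p)
      fun p hp => by simp only [if_neg hp]
    rw [TrueAt, ← key]
    refine realize_congr fun p hp => ?_
    by_cases hpb : p ∈ r.bound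
    · simp only [if_pos hpb]
    · simp only [if_neg hpb]
      rw [hv'' p hpb, hv' p fun h => Set.disjoint_left.1 hdisj h (vars_subset_varsOf hφ hp)]
  bound_structurality r₀ r σ h₀ hσ hfree hp hb hc v hv := by
    classical
    rw [hc, TrueAt, FirstOrder.Language.Term.realize_subst]
    refine h₀ _ fun φ hφ w hw => ?_
    -- Under this variant of `v`, `σ(φ)` has the value of `φ` under `w`: bound variables are fixed
    -- by `σ`, and the images of the free ones contain no bound variable.
    have key := hv (φ.subst σ) (by rw [hp]; exact ⟨φ, hφ, rfl⟩)
      (fun p => if p ∈ r₀.bound then w p else v p)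
      fun p hp => by rw [hb] at hp; simp only [if_neg hp]
    rw [TrueAt, FirstOrder.Language.Term.realize_subst] at key
    rw [TrueAt, ← key]
    refine realize_congr fun q hq => ?_
    by_cases hqb : q ∈ r₀.bound
    · rw [hσ q hqb]
      simp [hqb]
    · rw [hw q hqb]
      refine realize_congr fun p hpq => ?_
      rw [if_neg fun h => Set.disjoint_left.1
        (hfree q ⟨.inl (.inl (vars_subset_varsOf hφ hq)), hqb⟩) h hpq]

theorem isPi2RuleSystem_pi2 {L : Set (k.lang.Term V)} (K : Set (LAlgebra L)) :
    IsPi2RuleSystem (pi2 K) := by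
  have : pi2 K = ⋂₀ ((fun A : LAlgebra L => {r | Validates A.carrier r}) '' K) := by
    ext r
    simp [pi2]
  rw [this]
  refine isPi2RuleSystem_sInter ?_
  rintro _ ⟨A, _, rfl⟩
  exact isPi2RuleSystem_validates A.carrier

/-! ### Preservation of validity under `∀`-embeddings, products and ultraproducts. -/

theorem kind_relations_isEmpty (k : Kind.{u}) (n : ℕ) : IsEmpty (k.lang.Relations n) := by
  cases k <;> exact inferInstanceAs (IsEmpty Empty)

/-- A `∀`-embedding preserves universally quantified equations between terms over any set of
variables. -/
theorem IsForallEmbedding.realize_eq {ℒ : FirstOrder.Language.{u, 0}} {A B : Type u}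
    [ℒ.Structure A] [ℒ.Structure B] {f : A ↪[ℒ] B} (hf : IsForallEmbedding f) (s t : ℒ.Term V)
    (P : Set V) (v : V → A)
    (h : ∀ v' : V → A, (∀ p ∉ P, v' p = v p) → s.realize v' = t.realize v')
    (w : V → B) (hw : ∀ p ∉ P, w p = f (v p)) : s.realize w = t.realize w := by
  classical
  obtain ⟨n, g, hg⟩ := exists_injOn_fin ((finite_vars s).union (finite_vars t))
  -- The inverse of `g` needs a default variable. Without variables both terms are closed, and any
  -- embedding preserves the equation.
  by_cases hV : Nonempty V
  swap
  · have hV' := not_nonempty_iff.1 hV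
    have h₁ := congrArg f (h v fun p => hV'.elim p)
    rw [← FirstOrder.Language.HomClass.realize_term f,
      ← FirstOrder.Language.HomClass.realize_term f] at h₁
    rwa [Subsingleton.elim w (f ∘ v)]
  let F := vars s ∪ vars t
  -- Variables of `P` go to the quantified block, the others to the parameter block. The empty third
  -- block is the index of a formula without de Bruijn variables.
  let G : V → (Fin n ⊕ Fin n) ⊕ Fin 0 := fun p =>
    .inl (if p ∈ P then .inl (g p) else .inr (g p))
  let e : Fin n → V := Function.invFunOn g F
  have he : ∀ p ∈ F, e (g p) = p := fun p hp => hg.leftInvOn_invFunOn hp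
  have hstep : ∀ {C : Type u} [ℒ.Structure C] (r : ℒ.Term V) (x y : Fin n → C),
      (r.relabel G).realize (Sum.elim (Sum.elim x y) (default : Fin 0 → C)) =
        r.realize fun p => if p ∈ P then x (g p) else y (g p) := by
    intro C _ r x y
    rw [FirstOrder.Language.Term.realize_relabel]
    congr 1
    funext p
    by_cases hp : p ∈ P <;> simp [G, hp]
  have key := hf n n ((s.relabel G).bdEqual (t.relabel G))
    (.equal _ _) (fun i => v (e i)) ?_ (fun i => w (e i))
  · rw [FirstOrder.Language.Formula.Realize,
      FirstOrder.Language.BoundedFormula.realize_bdEqual,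
      hstep, hstep] at key
    have hw' : ∀ p ∈ F, w p =
        if p ∈ P then w (e (g p)) else (f ∘ fun i => v (e i)) (g p) := by
      intro p hp
      split_ifs with hpP
      · rw [he p hp]
      · simp only [Function.comp_apply]
        rw [he p hp, hw p hpP]
    rw [realize_congr fun p hp => hw' p (.inl hp), key]
    exact (realize_congr fun p hp => hw' p (.inr hp)).symm
  · intro x
    rw [FirstOrder.Language.Formula.Realize,
      FirstOrder.Language.BoundedFormula.realize_bdEqual,
      hstep, hstep]
    have h₁ := h (fun p => if p ∈ P then x (g p) else v p) fun p hp => if_neg hp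
    have hv' : ∀ p ∈ F, (if p ∈ P then x (g p) else v p) =
        if p ∈ P then x (g p) else v (e (g p)) := by
      intro p hp
      rw [he p hp]
    rw [realize_congr fun p hp => hv' p (.inl hp),
      realize_congr fun p hp => hv' p (.inr hp)] at h₁
    exact h₁

theorem realize_one_term {α : Type*} {A : Type*} [k.lang.Structure A] (v : α → A) :
    (k.one.term : k.lang.Term α).realize v = (k.one : A) :=
  FirstOrder.Language.Term.realize_constants

theorem map_one {A B F : Type*} [k.lang.Structure A] [k.lang.Structure B] [FunLike F A B]
    [k.lang.HomClass F A B] (f : F) : f (k.one : A) = (k.one : B) :=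
  FirstOrder.Language.HomClass.map_constants f k.one

theorem Validates.of_forallEmbedding {A B : Type u} [k.lang.Structure A] [k.lang.Structure B]
    {f : A ↪[k.lang] B} (hf : IsForallEmbedding f) {r : Pi2Rule k.lang V} (hB : Validates B r) :
    Validates A r := by
  intro v hv
  have key := hB (f ∘ v) fun φ hφ w hw => by
    have := hf.realize_eq φ k.one.term r.bound v
      (fun v' hv' => by rw [realize_one_term]; exact hv φ hφ v' hv') w hw
    rwa [realize_one_term] at this
  rw [TrueAt, FirstOrder.Language.HomClass.realize_term, ← map_one f] at key
  exact f.injective key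

/-- Validity is preserved under subdirect products whose projections are onto. -/
theorem Validates.of_jointly_injective {I : Type*} {A : Type u} {B : I → Type u}
    [k.lang.Structure A]
    [∀ i, k.lang.Structure (B i)] (π : ∀ i, A →[k.lang] B i)
    (hπ : ∀ i, Function.Surjective (π i))
    (hone : ∀ a, (∀ i, π i a = (k.one : B i)) → a = (k.one : A))
    {r : Pi2Rule k.lang V} (hB : ∀ i, Validates (B i) r) : Validates A r := by
  classical
  intro v hv
  refine hone _ fun i => ?_
  rw [← FirstOrder.Language.HomClass.realize_term]
  refine hB i _ fun φ hφ w hw => ?_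
  -- Surjectivity of the projection lifts the values at bound variables to `A`; elsewhere `w`
  -- already comes from `v`. The lift is a variant of `v`, so the premises hold there and project
  -- down.
  have hw' : w = π i ∘ fun p => if p ∈ r.bound then Function.surjInv (hπ i) (w p) else v p := by
    funext p
    by_cases hp : p ∈ r.bound
    · simp [hp, Function.surjInv_eq]
    · simp [hp, hw p hp]
  rw [hw', TrueAt, FirstOrder.Language.HomClass.realize_term,
    hv φ hφ _ fun p hp => if_neg hp, map_one]

theorem Validates.of_equiv {A B : Type u} [k.lang.Structure A] [k.lang.Structure B]
    (e : A ≃[k.lang] B) {r : Pi2Rule k.lang V} (hB : Validates B r) : Validates A r :=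
  Validates.of_jointly_injective (I := Unit) (B := fun _ => B) (fun _ => e.toHom)
    (fun _ => e.surjective) (fun _ ha => e.injective ((ha ()).trans (map_one e).symm))
    fun _ => hB

theorem Validates.pi {I : Type u} {B : I → Type u} [∀ i, k.lang.Structure (B i)]
    {r : Pi2Rule k.lang V} (hB : ∀ i, Validates (B i) r) : Validates (∀ i, B i) r := by
  classical
  have : ∀ i, Nonempty (B i) := fun i => ⟨(k.one : B i)⟩
  have hrel := kind_relations_isEmpty k
  let π : ∀ i, (∀ i, B i) →[k.lang] B i := fun i =>
    { toFun := fun a => a i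
      map_fun' := fun _ _ => rfl
      map_rel' := fun R => isEmptyElim R }
  refine Validates.of_jointly_injective π (fun i => Function.surjective_eval i) ?_ hB
  intro a ha
  funext i
  exact (ha i).trans (map_one (π i)).symm

/-- The element of an ultraproduct represented by an element of the direct product. -/
def ultraMk {I : Type u} (U : Ultrafilter I) {B : I → Type u} (x : ∀ i, B i) :
    (U : Filter I).Product B :=
  Quotient.mk ((U : Filter I).productSetoid B) x

theorem ultraproduct_realize_eq_iff {ℒ : FirstOrder.Language.{u, 0}} {I : Type u}
    {U : Ultrafilter I} {B : I → Type u}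
    [∀ i, ℒ.Structure (B i)] {α : Type*} (s t : ℒ.Term α) (v : α → ∀ i, B i) :
    s.realize (fun p => ultraMk U (v p)) =
        t.realize (fun p => ultraMk U (v p)) ↔
      ∀ᶠ i in U, s.realize (fun p => v p i) = t.realize (fun p => v p i) := by
  have h := FirstOrder.Language.Ultraproduct.term_realize_cast (L := ℒ) (u := U) v
  exact (iff_of_eq (congrArg₂ (· = ·) (h s) (h t))).trans Quotient.eq''

theorem ultraproduct_trueAt_iff {I : Type u} {U : Ultrafilter I} {B : I → Type u}
    [∀ i, k.lang.Structure (B i)] (φ : k.lang.Term V) (v : V → ∀ i, B i) :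
    TrueAt (fun p => ultraMk U (v p)) φ ↔
      ∀ᶠ i in U, TrueAt (fun p => v p i) φ := by
  have := ultraproduct_realize_eq_iff (U := U) φ k.one.term v
  simpa only [realize_one_term, TrueAt] using this

theorem exists_rep {I : Type u} {U : Ultrafilter I} {B : I → Type u} {α : Type*}
    (v : α → (U : Filter I).Product B) :
    ∃ v' : α → ∀ i, B i, v = fun p => ultraMk U (v' p) := by
  choose v' hv' using fun p => Quotient.exists_rep (v p)
  exact ⟨v', funext fun p => (hv' p).symm⟩

/-- A universally quantified premise that holds in the ultraproduct holds in almost every factor: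
otherwise counterexamples chosen in almost all factors would assemble to one in the ultraproduct.
Since there are finitely many premises, they hold together in almost every factor. -/
theorem Validates.ultraproduct {I : Type u} {U : Ultrafilter I} {B : I → Type u}
    [∀ i, k.lang.Structure (B i)] {r : Pi2Rule k.lang V} (hB : ∀ i, Validates (B i) r) :
    Validates ((U : Filter I).Product B) r := by
  classical
  intro v hv
  obtain ⟨v, rfl⟩ := exists_rep v
  rw [ultraproduct_trueAt_iff]
  have h : ∀ φ ∈ r.prem, ∀ᶠ i in U,
      ∀ w : V → B i, (∀ p ∉ r.bound, w p = v p i) → TrueAt w φ := by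
    intro φ hφ
    by_contra hcon
    rw [← Ultrafilter.eventually_not] at hcon
    -- In factors without a counterexample `v` itself is taken, so that the choice is defined for
    -- every index.
    have hw : ∀ i, ∃ w : V → B i, (∀ p ∉ r.bound, w p = v p i) ∧
        ((¬ ∀ w : V → B i, (∀ p ∉ r.bound, w p = v p i) → TrueAt w φ) → ¬ TrueAt w φ) := by
      intro i
      by_cases h : ∀ w : V → B i, (∀ p ∉ r.bound, w p = v p i) → TrueAt w φ
      · exact ⟨fun p => v p i, fun _ _ => rfl, fun h' => (h' h).elim⟩
      · push Not at h
        obtain ⟨w, hw, hw'⟩ := h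
        exact ⟨w, hw, fun _ => hw'⟩
    choose w hw hw' using hw
    have h₁ := hv φ hφ (fun p => ultraMk U fun i => w i p)
      fun p hp => congrArg _ (funext fun i => hw i p hp)
    rw [ultraproduct_trueAt_iff] at h₁
    obtain ⟨i, hi₁, hi₂⟩ := (h₁.and hcon).exists
    exact hw' i hi₂ hi₁
  filter_upwards [(Filter.eventually_all_finite r.prem_finite).2 h] with i hi
  exact hB i _ fun φ hφ w hw => hi φ hφ w hw

theorem isInductiveRuleClass_ind (L : Set (k.lang.Term V)) (S : Set (Pi2Rule k.lang V)) :
    IsInductiveRuleClass (ind L S) where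
  forall_sub _ _ _ hf hB r hr := (hB r hr).of_forallEmbedding hf
  prod _ _ _ hB := fun ⟨e⟩ r hr => (Validates.pi fun i => hB i r hr).of_equiv e
  ultraprod _ _ _ _ hB := fun ⟨e⟩ r hr => (Validates.ultraproduct fun i => hB i r hr).of_equiv e

end Soundness

/-! ### Values of terms with at most two immediate subterms. -/

section Realize

variable {ℒ : FirstOrder.Language.{u, 0}} {α : Type*} {A : Type*} [ℒ.Structure A]

theorem realize_func₀ (f : ℒ.Functions 0) (v : α → A) :
    (FirstOrder.Language.Term.func f ![] : ℒ.Term α).realize v =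
      FirstOrder.Language.Structure.funMap f ![] := by
  simp only [FirstOrder.Language.Term.realize]
  exact congrArg _ (Subsingleton.elim _ _)

theorem realize_func₁ (f : ℒ.Functions 1) (s : ℒ.Term α) (v : α → A) :
    (FirstOrder.Language.Term.func f ![s] : ℒ.Term α).realize v =
      FirstOrder.Language.Structure.funMap f ![s.realize v] := by
  simp only [FirstOrder.Language.Term.realize]
  congr 1
  funext i
  fin_cases i
  rfl

theorem realize_func₂ (f : ℒ.Functions 2) (s t : ℒ.Term α) (v : α → A) :
    (FirstOrder.Language.Term.func f ![s, t] : ℒ.Term α).realize v =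
      FirstOrder.Language.Structure.funMap f ![s.realize v, t.realize v] := by
  simp only [FirstOrder.Language.Term.realize]
  congr 1
  funext i
  fin_cases i <;> rfl

theorem exists_eq_vec₁ {α : Type*} (x : Fin 1 → α) : ∃ a, x = ![a] :=
  ⟨x 0, by funext i; fin_cases i; rfl⟩

theorem exists_eq_vec₂ {α : Type*} (x : Fin 2 → α) : ∃ a b, x = ![a, b] :=
  ⟨x 0, x 1, by funext i; fin_cases i <;> rfl⟩

end Realize

/-! ### Intuitionistic theories -/

namespace IntL

variable {V : Type u}

/-- A set of formulas that contains the intuitionistic axioms and is closed under modus ponens. -/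
structure IsTheory (T : Set (intLang.Term V)) : Prop where
  ax : ∀ a, IPCAxiom a → a ∈ T
  mp : ∀ a b, imp a b ∈ T → a ∈ T → b ∈ T

/-- The biconditional `(a → b) ∧ (b → a)`. -/
def iff (a b : intLang.Term V) : intLang.Term V := and (imp a b) (imp b a)

namespace IsTheory

variable {T : Set (intLang.Term V)} {a b c d : intLang.Term V}

theorem weaken (hT : IsTheory T) (h : a ∈ T) : imp b a ∈ T := hT.mp _ _ (hT.ax _ (.weaken a b)) h

theorem distrib (hT : IsTheory T) (h : imp a (imp b c) ∈ T) (h' : imp a b ∈ T) : imp a c ∈ T :=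
  hT.mp _ _ (hT.mp _ _ (hT.ax _ (.distrib a b c)) h) h'

/-- The combinator identity `I = S K K`. -/
theorem refl (hT : IsTheory T) (a : intLang.Term V) : imp a a ∈ T :=
  hT.distrib (hT.ax _ (.weaken a (imp a a))) (hT.ax _ (.weaken a a))

theorem trans (hT : IsTheory T) (h : imp a b ∈ T) (h' : imp b c ∈ T) : imp a c ∈ T :=
  hT.distrib (hT.weaken h') h

theorem le_inf (hT : IsTheory T) (h : imp a b ∈ T) (h' : imp a c ∈ T) : imp a (and b c) ∈ T :=
  hT.distrib (hT.trans h (hT.ax _ (.and_intro b c))) h'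

theorem sup_le (hT : IsTheory T) (h : imp a c ∈ T) (h' : imp b c ∈ T) : imp (or a b) c ∈ T :=
  hT.mp _ _ (hT.mp _ _ (hT.ax _ (.or_elim a b c)) h) h'

theorem curry (hT : IsTheory T) (h : imp (and a b) c ∈ T) : imp a (imp b c) ∈ T :=
  hT.trans (hT.ax _ (.and_intro a b))
    (hT.mp _ _ (hT.ax _ (.distrib b (and a b) c)) (hT.weaken h))

theorem uncurry (hT : IsTheory T) (h : imp a (imp b c) ∈ T) : imp (and a b) c ∈ T :=
  hT.distrib (hT.trans (hT.ax _ (.and_left a b)) h) (hT.ax _ (.and_right a b))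

theorem le_top (hT : IsTheory T) : imp a top ∈ T := hT.weaken (hT.ax _ .verum)

theorem mem_iff_top_imp (hT : IsTheory T) : imp top a ∈ T ↔ a ∈ T :=
  ⟨fun h => hT.mp _ _ h (hT.ax _ .verum), fun h => hT.weaken h⟩

theorem inf_mono (hT : IsTheory T) (h : imp a b ∈ T) (h' : imp c d ∈ T) :
    imp (and a c) (and b d) ∈ T :=
  hT.le_inf (hT.trans (hT.ax _ (.and_left a c)) h) (hT.trans (hT.ax _ (.and_right a c)) h')

theorem sup_mono (hT : IsTheory T) (h : imp a b ∈ T) (h' : imp c d ∈ T) :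
    imp (or a c) (or b d) ∈ T :=
  hT.sup_le (hT.trans h (hT.ax _ (.or_left b d))) (hT.trans h' (hT.ax _ (.or_right b d)))

theorem himp_mono (hT : IsTheory T) (h : imp b a ∈ T) (h' : imp c d ∈ T) :
    imp (imp a c) (imp b d) ∈ T :=
  hT.curry (hT.trans (hT.inf_mono (hT.refl _) h) (hT.trans (hT.uncurry (hT.refl _)) h'))

theorem iff_mem (hT : IsTheory T) : iff a b ∈ T ↔ imp a b ∈ T ∧ imp b a ∈ T :=
  ⟨fun h => ⟨hT.mp _ _ (hT.ax _ (.and_left _ _)) h, hT.mp _ _ (hT.ax _ (.and_right _ _)) h⟩,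
    fun h => hT.mp _ _ (hT.mp _ _ (hT.ax _ (.and_intro _ _)) h.1) h.2⟩

/-- Provable equivalence is a congruence, so the connectives descend to the Lindenbaum–Tarski
algebra. Implication is antitone in its first argument, which swaps the two directions there. -/
theorem iff_func (hT : IsTheory T) {n : ℕ} (f : intLang.Functions n) (x y : Fin n → intLang.Term V)
    (h : ∀ i, iff (x i) (y i) ∈ T) : iff (.func f x) (.func f y) ∈ T := by
  simp only [hT.iff_mem] at h ⊢
  cases f with
  | bot => rw [Subsingleton.elim x y]; exact ⟨hT.refl _, hT.refl _⟩
  | top => rw [Subsingleton.elim x y]; exact ⟨hT.refl _, hT.refl _⟩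
  | and =>
    obtain ⟨⟨a, b, rfl⟩, c, d, rfl⟩ := And.intro (exists_eq_vec₂ x) (exists_eq_vec₂ y)
    exact ⟨hT.inf_mono (h 0).1 (h 1).1, hT.inf_mono (h 0).2 (h 1).2⟩
  | or =>
    obtain ⟨⟨a, b, rfl⟩, c, d, rfl⟩ := And.intro (exists_eq_vec₂ x) (exists_eq_vec₂ y)
    exact ⟨hT.sup_mono (h 0).1 (h 1).1, hT.sup_mono (h 0).2 (h 1).2⟩
  | imp =>
    obtain ⟨⟨a, b, rfl⟩, c, d, rfl⟩ := And.intro (exists_eq_vec₂ x) (exists_eq_vec₂ y)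
    exact ⟨hT.himp_mono (h 0).2 (h 1).1, hT.himp_mono (h 0).1 (h 1).2⟩

end IsTheory

/-- A structure in which the formulas true under any valuation form a theory, and in which
equivalent elements are equal, is a Heyting algebra. -/
theorem isAlgebra_of_isTheory [Infinite V] {A : Type u} [intLang.Structure A] (one : A)
    (hone : one = FirstOrder.Language.Structure.funMap (L := intLang) (n := 0) IntConn.top ![])
    (hT : ∀ v : V → A, IsTheory {φ : intLang.Term V | φ.realize v = one})
    (hE : ∀ (v : V → A) (p q : V), (iff (.var p) (.var q)).realize v = one → v p = v q) :
    IsAlgebra A := by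
  let andM (x y : A) : A :=
    FirstOrder.Language.Structure.funMap (L := intLang) (n := 2) IntConn.and ![x, y]
  let orM (x y : A) : A :=
    FirstOrder.Language.Structure.funMap (L := intLang) (n := 2) IntConn.or ![x, y]
  let impM (x y : A) : A :=
    FirstOrder.Language.Structure.funMap (L := intLang) (n := 2) IntConn.imp ![x, y]
  let botM : A := FirstOrder.Language.Structure.funMap (L := intLang) (n := 0) IntConn.bot ![]
  have hand (v : V → A) (s t) : (and s t).realize v = andM (s.realize v) (t.realize v) :=
    realize_func₂ (ℒ := intLang) _ _ _ _
  have hor (v : V → A) (s t) : (or s t).realize v = orM (s.realize v) (t.realize v) :=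
    realize_func₂ (ℒ := intLang) _ _ _ _
  have himp (v : V → A) (s t) : (imp s t).realize v = impM (s.realize v) (t.realize v) :=
    realize_func₂ (ℒ := intLang) _ _ _ _
  have hbot (v : V → A) : (bot : intLang.Term V).realize v = botM :=
    realize_func₀ (ℒ := intLang) _ _
  have htop (v : V → A) : (top : intLang.Term V).realize v = one :=
    (realize_func₀ (ℒ := intLang) _ _).trans hone.symm
  have hmem (v : V → A) (φ : intLang.Term V) : φ ∈ {φ : intLang.Term V | φ.realize v = one} ↔
    φ.realize v = one := Iff.rfl
  have hvar (v : V → A) (p : V) : (.var p : intLang.Term V).realize v = v p := rfl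
  -- The order is `a → b = 1`. Each law is the corresponding theorem of the theory, evaluated where
  -- variables take the given elements as values.
  let H : HeytingAlgebra A :=
    { le := fun a b => impM a b = one
      le_refl := fun a => by
        obtain ⟨v, p, q, r, rfl, -, -⟩ := exists_valuation V a a a
        simpa only [hmem, himp, hvar] using (hT v).refl (.var p)
      le_trans := fun a b c h₁ h₂ => by
        obtain ⟨v, p, q, r, rfl, rfl, rfl⟩ := exists_valuation V a b c
        have := (hT v).trans (a := .var p) (b := .var q) (c := .var r)
        simp only [hmem, himp, hvar] at this
        exact this h₁ h₂
      le_antisymm := fun a b h₁ h₂ => by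
        obtain ⟨v, p, q, r, rfl, rfl, -⟩ := exists_valuation V a b b
        have := (hT v).iff_mem (a := .var p) (b := .var q)
        simp only [hmem, himp, hvar] at this
        exact hE v p q (this.2 ⟨h₁, h₂⟩)
      inf := andM
      inf_le_left := fun a b => by
        obtain ⟨v, p, q, r, rfl, rfl, -⟩ := exists_valuation V a b b
        simpa only [hmem, himp, hand, hvar] using (hT v).ax _ (.and_left (.var p) (.var q))
      inf_le_right := fun a b => by
        obtain ⟨v, p, q, r, rfl, rfl, -⟩ := exists_valuation V a b b
        simpa only [hmem, himp, hand, hvar] using (hT v).ax _ (.and_right (.var p) (.var q))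
      le_inf := fun a b c h₁ h₂ => by
        obtain ⟨v, p, q, r, rfl, rfl, rfl⟩ := exists_valuation V a b c
        have := (hT v).le_inf (a := .var p) (b := .var q) (c := .var r)
        simp only [hmem, himp, hand, hvar] at this
        exact this h₁ h₂
      sup := orM
      le_sup_left := fun a b => by
        obtain ⟨v, p, q, r, rfl, rfl, -⟩ := exists_valuation V a b b
        simpa only [hmem, himp, hor, hvar] using (hT v).ax _ (.or_left (.var p) (.var q))
      le_sup_right := fun a b => by
        obtain ⟨v, p, q, r, rfl, rfl, -⟩ := exists_valuation V a b b
        simpa only [hmem, himp, hor, hvar] using (hT v).ax _ (.or_right (.var p) (.var q))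
      sup_le := fun a b c h₁ h₂ => by
        obtain ⟨v, p, q, r, rfl, rfl, rfl⟩ := exists_valuation V a b c
        have := (hT v).sup_le (a := .var p) (b := .var q) (c := .var r)
        simp only [hmem, himp, hor, hvar] at this
        exact this h₁ h₂
      top := one
      le_top := fun a => by
        obtain ⟨v, p, q, r, rfl, -, -⟩ := exists_valuation V a a a
        simpa only [hmem, himp, htop, hvar] using (hT v).le_top (a := .var p)
      bot := botM
      bot_le := fun a => by
        obtain ⟨v, p, q, r, rfl, -, -⟩ := exists_valuation V a a a
        simpa only [hmem, himp, hbot, hvar] using (hT v).ax _ (.falsum (.var p))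
      himp := impM
      le_himp_iff := fun a b c => by
        obtain ⟨v, p, q, r, rfl, rfl, rfl⟩ := exists_valuation V a b c
        have h₁ := (hT v).uncurry (a := .var p) (b := .var q) (c := .var r)
        have h₂ := (hT v).curry (a := .var p) (b := .var q) (c := .var r)
        simp only [hmem, himp, hand, hvar] at h₁ h₂
        exact ⟨h₁, h₂⟩
      compl := fun a => impM a botM
      himp_bot := fun _ => rfl }
  exact ⟨H, rfl, hone.symm, fun _ _ => rfl, fun _ _ => rfl, fun _ _ => rfl⟩

section

variable {A : Type u} [intLang.Structure A]

theorem IsAlgebra.realize_iff_eq_top (hA : IsAlgebra A) (v : V → A)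
    (s t : intLang.Term V) :
    (iff s t).realize v =
        FirstOrder.Language.Structure.funMap (L := intLang) (n := 0) IntConn.top ![] ↔
      s.realize v = t.realize v := by
  obtain ⟨H, -, ht, ha, -, hi⟩ := hA
  have h₁ : (iff s t).realize v = (s.realize v ⇨ t.realize v) ⊓ (t.realize v ⇨ s.realize v) := by
    refine (realize_func₂ (ℒ := intLang) _ _ _ _).trans ((ha _ _).trans (congrArg₂ _ ?_ ?_)) <;>
      exact (realize_func₂ (ℒ := intLang) _ _ _ _).trans (hi _ _)
  rw [h₁, ht, inf_eq_top_iff, himp_eq_top_iff, himp_eq_top_iff, le_antisymm_iff]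

theorem IsAlgebra.realize_mp (hA : IsAlgebra A) (v : V → A)
    (s t : intLang.Term V)
    (h : s.realize v =
      FirstOrder.Language.Structure.funMap (L := intLang) (n := 0) IntConn.top ![])
    (h' : (imp s t).realize v =
      FirstOrder.Language.Structure.funMap (L := intLang) (n := 0) IntConn.top ![]) :
    t.realize v =
      FirstOrder.Language.Structure.funMap (L := intLang) (n := 0) IntConn.top ![] := by
  obtain ⟨H, -, ht, ha, -, hi⟩ := hA
  have h₁ : (imp s t).realize v = s.realize v ⇨ t.realize v :=
    (realize_func₂ (ℒ := intLang) _ _ _ _).trans (hi _ _)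
  rw [ht] at h h' ⊢
  rwa [h₁, h, top_himp] at h'

end

end IntL

/-! ### Modal theories -/

namespace ModL

variable {ι V : Type u}

/-- A set of formulas that contains the tautologies and the normality and duality axioms, and is
closed under modus ponens and necessitation. -/
structure IsTheory (T : Set ((modLang ι).Term V)) : Prop where
  taut : ∀ a, IsTautology a → a ∈ T
  normal : ∀ i a b, imp (box i (imp a b)) (imp (box i a) (box i b)) ∈ T
  dual : ∀ i a, iff (dia i a) (neg (box i (neg a))) ∈ T
  mp : ∀ a b, imp a b ∈ T → a ∈ T → b ∈ T
  nec : ∀ i, ∀ a ∈ T, box i a ∈ T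

namespace IsTheory

variable {T : Set ((modLang ι).Term V)} {a b c d : (modLang ι).Term V}

theorem of_taut₁ (hT : IsTheory T) (h : a ∈ T) (h' : IsTautology (imp a b)) : b ∈ T :=
  hT.mp _ _ (hT.taut _ h') h

theorem of_taut₂ (hT : IsTheory T) (h₁ : a ∈ T) (h₂ : b ∈ T) (h' : IsTautology (imp a (imp b c))) :
    c ∈ T :=
  hT.mp _ _ (hT.of_taut₁ h₁ h') h₂

theorem refl (hT : IsTheory T) (a : (modLang ι).Term V) : imp a a ∈ T := by
  refine hT.taut _ fun w _ _ hn ha ho => ?_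
  simp only [imp, hn, ho]; tauto

theorem trans (hT : IsTheory T) (h : imp a b ∈ T) (h' : imp b c ∈ T) : imp a c ∈ T := by
  refine hT.of_taut₂ h h' fun w _ _ hn ha ho => ?_
  simp only [imp, hn, ho]; tauto

theorem inf_le_left (hT : IsTheory T) : imp (and a b) a ∈ T := by
  refine hT.taut _ fun w _ _ hn ha ho => ?_
  simp only [imp, hn, ha, ho]; tauto

theorem inf_le_right (hT : IsTheory T) : imp (and a b) b ∈ T := by
  refine hT.taut _ fun w _ _ hn ha ho => ?_
  simp only [imp, hn, ha, ho]; tauto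

theorem le_inf (hT : IsTheory T) (h : imp a b ∈ T) (h' : imp a c ∈ T) : imp a (and b c) ∈ T := by
  refine hT.of_taut₂ h h' fun w _ _ hn ha ho => ?_
  simp only [imp, hn, ha, ho]; tauto

theorem le_sup_left (hT : IsTheory T) : imp a (or a b) ∈ T := by
  refine hT.taut _ fun w _ _ hn ha ho => ?_
  simp only [imp, hn, ho]; tauto

theorem le_sup_right (hT : IsTheory T) : imp b (or a b) ∈ T := by
  refine hT.taut _ fun w _ _ hn ha ho => ?_
  simp only [imp, hn, ho]; tauto

theorem sup_le (hT : IsTheory T) (h : imp a c ∈ T) (h' : imp b c ∈ T) : imp (or a b) c ∈ T := by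
  refine hT.of_taut₂ h h' fun w _ _ hn ha ho => ?_
  simp only [imp, hn, ho]; tauto

theorem le_sup_inf (hT : IsTheory T) : imp (and (or a b) (or a c)) (or a (and b c)) ∈ T := by
  refine hT.taut _ fun w _ _ hn ha ho => ?_
  simp only [imp, hn, ha, ho]; tauto

theorem inf_compl_le_bot (hT : IsTheory T) : imp (and a (neg a)) bot ∈ T := by
  refine hT.taut _ fun w hb _ hn ha ho => ?_
  simp only [imp, hn, ha, ho, hb]; tauto

theorem top_le_sup_compl (hT : IsTheory T) : imp top (or a (neg a)) ∈ T := by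
  refine hT.taut _ fun w _ ht hn ha ho => ?_
  simp only [imp, hn, ho, ht]; tauto

theorem top_mem (hT : IsTheory T) : (top : (modLang ι).Term V) ∈ T :=
  hT.taut _ fun _ _ ht _ _ _ => ht.2 trivial

theorem le_top (hT : IsTheory T) : imp a top ∈ T := by
  refine hT.taut _ fun w _ ht hn ha ho => ?_
  simp only [imp, hn, ho, ht]; tauto

theorem bot_le (hT : IsTheory T) : imp bot a ∈ T := by
  refine hT.taut _ fun w hb _ hn ha ho => ?_
  simp only [imp, hn, ho, hb]; tauto

theorem mem_iff_top_imp (hT : IsTheory T) : imp top a ∈ T ↔ a ∈ T := by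
  refine ⟨fun h => hT.mp _ _ h hT.top_mem, fun h => hT.of_taut₁ h fun w _ ht hn ha ho => ?_⟩
  simp only [imp, hn, ho, ht]; tauto

theorem inf_mono (hT : IsTheory T) (h : imp a b ∈ T) (h' : imp c d ∈ T) :
    imp (and a c) (and b d) ∈ T :=
  hT.le_inf (hT.trans hT.inf_le_left h) (hT.trans hT.inf_le_right h')

theorem sup_mono (hT : IsTheory T) (h : imp a b ∈ T) (h' : imp c d ∈ T) :
    imp (or a c) (or b d) ∈ T :=
  hT.sup_le (hT.trans h hT.le_sup_left) (hT.trans h' hT.le_sup_right)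

theorem compl_anti (hT : IsTheory T) (h : imp a b ∈ T) : imp (neg b) (neg a) ∈ T := by
  refine hT.of_taut₁ h fun w _ _ hn ha ho => ?_
  simp only [imp, hn, ho]; tauto

theorem iff_mem (hT : IsTheory T) : iff a b ∈ T ↔ imp a b ∈ T ∧ imp b a ∈ T := by
  refine ⟨fun h => ⟨hT.mp _ _ hT.inf_le_left h, hT.mp _ _ hT.inf_le_right h⟩,
    fun h => hT.of_taut₂ h.1 h.2 fun w _ _ hn ha ho => ?_⟩
  simp only [iff, imp, hn, ho, ha]; tauto

theorem box_mono (hT : IsTheory T) (i : ι) (h : imp a b ∈ T) : imp (box i a) (box i b) ∈ T :=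
  hT.mp _ _ (hT.normal i a b) (hT.nec i _ h)

theorem dia_le_neg_box_neg (hT : IsTheory T) (i : ι) (a : (modLang ι).Term V) :
    imp (dia i a) (neg (box i (neg a))) ∈ T :=
  (hT.iff_mem.1 (hT.dual i a)).1

theorem neg_box_neg_le_dia (hT : IsTheory T) (i : ι) (a : (modLang ι).Term V) :
    imp (neg (box i (neg a))) (dia i a) ∈ T :=
  (hT.iff_mem.1 (hT.dual i a)).2

theorem dia_mono (hT : IsTheory T) (i : ι) (h : imp a b ∈ T) : imp (dia i a) (dia i b) ∈ T :=
  hT.trans (hT.dia_le_neg_box_neg i a)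
    (hT.trans (hT.compl_anti (hT.box_mono i (hT.compl_anti h))) (hT.neg_box_neg_le_dia i b))

/-- `□¬0` is a theorem by necessitation, and `◇0` implies its negation. -/
theorem dia_bot_le (hT : IsTheory T) (i : ι) : imp (dia i bot) bot ∈ T := by
  have h₁ : neg bot ∈ T := hT.taut _ fun w hb _ hn _ _ => by simp only [hn, hb]; tauto
  refine hT.of_taut₂ (hT.nec i _ h₁) (hT.dia_le_neg_box_neg i bot) fun w hb _ hn _ ho => ?_
  simp only [imp, hn, ho, hb]; tauto

theorem dia_sup_le (hT : IsTheory T) (i : ι) :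
    imp (dia i (or a b)) (or (dia i a) (dia i b)) ∈ T := by
  -- Boxing this tautology gives `□¬a → (□¬b → □¬(a ∨ b))`, whose contrapositive is the claim up to
  -- duality.
  have h₁ : imp (neg a) (imp (neg b) (neg (or a b))) ∈ T := by
    refine hT.taut _ fun w _ _ hn _ ho => ?_
    simp only [imp, hn, ho]; tauto
  have h₂ := hT.trans (hT.box_mono i h₁) (hT.normal i (neg b) (neg (or a b)))
  have h₃ : imp (dia i (or a b)) (or (neg (box i (neg a))) (neg (box i (neg b)))) ∈ T := by
    refine hT.of_taut₂ h₂ (hT.dia_le_neg_box_neg i (or a b)) fun w _ _ hn _ ho => ?_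
    simp only [imp, hn, ho]; tauto
  exact hT.trans h₃ (hT.sup_mono (hT.neg_box_neg_le_dia i a) (hT.neg_box_neg_le_dia i b))

theorem iff_func (hT : IsTheory T) {n : ℕ} (f : (modLang ι).Functions n)
    (x y : Fin n → (modLang ι).Term V)
    (h : ∀ i, iff (x i) (y i) ∈ T) : iff (.func f x) (.func f y) ∈ T := by
  simp only [hT.iff_mem] at h ⊢
  cases f with
  | bot => rw [Subsingleton.elim x y]; exact ⟨hT.refl _, hT.refl _⟩
  | top => rw [Subsingleton.elim x y]; exact ⟨hT.refl _, hT.refl _⟩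
  | neg =>
    obtain ⟨⟨a, rfl⟩, c, rfl⟩ := And.intro (exists_eq_vec₁ x) (exists_eq_vec₁ y)
    exact ⟨hT.compl_anti (h 0).2, hT.compl_anti (h 0).1⟩
  | dia i =>
    obtain ⟨⟨a, rfl⟩, c, rfl⟩ := And.intro (exists_eq_vec₁ x) (exists_eq_vec₁ y)
    exact ⟨hT.dia_mono i (h 0).1, hT.dia_mono i (h 0).2⟩
  | and =>
    obtain ⟨⟨a, b, rfl⟩, c, d, rfl⟩ := And.intro (exists_eq_vec₂ x) (exists_eq_vec₂ y)
    exact ⟨hT.inf_mono (h 0).1 (h 1).1, hT.inf_mono (h 0).2 (h 1).2⟩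
  | or =>
    obtain ⟨⟨a, b, rfl⟩, c, d, rfl⟩ := And.intro (exists_eq_vec₂ x) (exists_eq_vec₂ y)
    exact ⟨hT.sup_mono (h 0).1 (h 1).1, hT.sup_mono (h 0).2 (h 1).2⟩

end IsTheory

/-- A structure in which the formulas true under any valuation form a theory, and in which
equivalent elements are equal, is a modal algebra. -/
theorem isAlgebra_of_isTheory [Infinite V] {A : Type u} [(modLang ι).Structure A] (one : A)
    (hone : one = FirstOrder.Language.Structure.funMap (L := modLang ι) (n := 0) ModConn.top ![])
    (hT : ∀ v : V → A, IsTheory {φ : (modLang ι).Term V | φ.realize v = one})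
    (hE : ∀ (v : V → A) (p q : V), (iff (ι := ι) (.var p) (.var q)).realize v = one → v p = v q) :
    IsAlgebra (ι := ι) A := by
  let andM (x y : A) : A :=
    FirstOrder.Language.Structure.funMap (L := modLang ι) (n := 2) ModConn.and ![x, y]
  let orM (x y : A) : A :=
    FirstOrder.Language.Structure.funMap (L := modLang ι) (n := 2) ModConn.or ![x, y]
  let negM (x : A) : A :=
    FirstOrder.Language.Structure.funMap (L := modLang ι) (n := 1) ModConn.neg ![x]
  let botM : A := FirstOrder.Language.Structure.funMap (L := modLang ι) (n := 0) ModConn.bot ![]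
  have hand (v : V → A) (s t : (modLang ι).Term V) :
      (and s t).realize v = andM (s.realize v) (t.realize v) :=
    realize_func₂ (ℒ := modLang ι) _ _ _ _
  have hor (v : V → A) (s t : (modLang ι).Term V) :
      (or s t).realize v = orM (s.realize v) (t.realize v) :=
    realize_func₂ (ℒ := modLang ι) _ _ _ _
  have hneg (v : V → A) (s : (modLang ι).Term V) : (neg s).realize v = negM (s.realize v) :=
    realize_func₁ (ℒ := modLang ι) _ _ _
  have hdia (v : V → A) (i : ι) (s : (modLang ι).Term V) :
      (dia i s).realize v = diaMap i (s.realize v) :=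
    realize_func₁ (ℒ := modLang ι) _ _ _
  have himp (v : V → A) (s t : (modLang ι).Term V) :
      (imp s t).realize v = orM (negM (s.realize v)) (t.realize v) := by
    rw [imp, hor, hneg]
  have hbot (v : V → A) : (bot : (modLang ι).Term V).realize v = botM :=
    realize_func₀ (ℒ := modLang ι) _ _
  have htop (v : V → A) : (top : (modLang ι).Term V).realize v = one :=
    (realize_func₀ (ℒ := modLang ι) _ _).trans hone.symm
  have hmem (v : V → A) (φ : (modLang ι).Term V) :
    φ ∈ {φ : (modLang ι).Term V | φ.realize v = one} ↔ φ.realize v = one := Iff.rfl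
  have hvar (v : V → A) (p : V) : (.var p : (modLang ι).Term V).realize v = v p := rfl
  -- The order is `¬a ∨ b = 1`, i.e. `a → b = 1`.
  let DL : DistribLattice A :=
    { le := fun a b => orM (negM a) b = one
      le_refl := fun a => by
        obtain ⟨v, p, q, r, rfl, -, -⟩ := exists_valuation V a a a
        simpa only [hmem, himp, hvar] using (hT v).refl (.var p)
      le_trans := fun a b c h₁ h₂ => by
        obtain ⟨v, p, q, r, rfl, rfl, rfl⟩ := exists_valuation V a b c
        have := (hT v).trans (a := .var p) (b := .var q) (c := .var r)
        simp only [hmem, himp, hvar] at this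
        exact this h₁ h₂
      le_antisymm := fun a b h₁ h₂ => by
        obtain ⟨v, p, q, r, rfl, rfl, -⟩ := exists_valuation V a b b
        have := (hT v).iff_mem (a := .var p) (b := .var q)
        simp only [hmem, himp, hvar] at this
        exact hE v p q (this.2 ⟨h₁, h₂⟩)
      inf := andM
      inf_le_left := fun a b => by
        obtain ⟨v, p, q, r, rfl, rfl, -⟩ := exists_valuation V a b b
        simpa only [hmem, himp, hand, hvar] using
          (hT v).inf_le_left (a := .var p) (b := .var q)
      inf_le_right := fun a b => by
        obtain ⟨v, p, q, r, rfl, rfl, -⟩ := exists_valuation V a b b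
        simpa only [hmem, himp, hand, hvar] using
          (hT v).inf_le_right (a := .var p) (b := .var q)
      le_inf := fun a b c h₁ h₂ => by
        obtain ⟨v, p, q, r, rfl, rfl, rfl⟩ := exists_valuation V a b c
        have := (hT v).le_inf (a := .var p) (b := .var q) (c := .var r)
        simp only [hmem, himp, hand, hvar] at this
        exact this h₁ h₂
      sup := orM
      le_sup_left := fun a b => by
        obtain ⟨v, p, q, r, rfl, rfl, -⟩ := exists_valuation V a b b
        simpa only [hmem, himp, hor, hvar] using
          (hT v).le_sup_left (a := .var p) (b := .var q)
      le_sup_right := fun a b => by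
        obtain ⟨v, p, q, r, rfl, rfl, -⟩ := exists_valuation V a b b
        simpa only [hmem, himp, hor, hvar] using
          (hT v).le_sup_right (a := .var p) (b := .var q)
      sup_le := fun a b c h₁ h₂ => by
        obtain ⟨v, p, q, r, rfl, rfl, rfl⟩ := exists_valuation V a b c
        have := (hT v).sup_le (a := .var p) (b := .var q) (c := .var r)
        simp only [hmem, himp, hor, hvar] at this
        exact this h₁ h₂
      le_sup_inf := fun a b c => by
        obtain ⟨v, p, q, r, rfl, rfl, rfl⟩ := exists_valuation V a b c
        have := (hT v).le_sup_inf (a := .var p) (b := .var q) (c := .var r)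
        simp only [hmem, himp, hor, hand, hvar] at this
        exact this }
  let H : BooleanAlgebra A :=
    { DL with
      top := one
      le_top := fun a => by
        obtain ⟨v, p, q, r, rfl, -, -⟩ := exists_valuation V a a a
        have := (hT v).le_top (a := .var p)
        simp only [hmem, himp, htop, hvar] at this
        exact this
      bot := botM
      bot_le := fun a => by
        obtain ⟨v, p, q, r, rfl, -, -⟩ := exists_valuation V a a a
        have := (hT v).bot_le (a := .var p)
        simp only [hmem, himp, hbot, hvar] at this
        exact this
      compl := negM
      inf_compl_le_bot := fun a => by
        obtain ⟨v, p, q, r, rfl, -, -⟩ := exists_valuation V a a a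
        have := (hT v).inf_compl_le_bot (a := .var p)
        simp only [hmem, himp, hand, hneg, hbot, hvar] at this
        exact this
      top_le_sup_compl := fun a => by
        obtain ⟨v, p, q, r, rfl, -, -⟩ := exists_valuation V a a a
        have := (hT v).top_le_sup_compl (a := .var p)
        simp only [hmem, himp, hor, hneg, htop, hvar] at this
        exact this }
  refine ⟨H, rfl, hone.symm, fun _ => rfl, fun _ _ => rfl, fun _ _ => rfl, fun i => ?_,
    fun i a b => ?_⟩
  · refine le_antisymm ?_ bot_le
    obtain ⟨v, -⟩ := exists_valuation V one one one
    have := (hT v).dia_bot_le i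
    simp only [hmem, himp, hdia, hbot] at this
    exact this
  · obtain ⟨v, p, q, r, rfl, rfl, -⟩ := exists_valuation V a b b
    refine le_antisymm ?_ (sup_le ?_ ?_)
    · have := (hT v).dia_sup_le i (a := .var p) (b := .var q)
      simp only [hmem, himp, hdia, hor, hvar] at this
      exact this
    · have := (hT v).dia_mono i ((hT v).le_sup_left (a := .var p) (b := .var q))
      simp only [hmem, himp, hdia, hor, hvar] at this
      exact this
    · have := (hT v).dia_mono i ((hT v).le_sup_right (a := .var p) (b := .var q))
      simp only [hmem, himp, hdia, hor, hvar] at this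
      exact this

section

variable {A : Type u} [(modLang ι).Structure A]

theorem IsAlgebra.realize_iff_eq_top (hA : IsAlgebra (ι := ι) A) (v : V → A)
    (s t : (modLang ι).Term V) :
    (iff s t).realize v =
        FirstOrder.Language.Structure.funMap (L := modLang ι) (n := 0) ModConn.top ![] ↔
      s.realize v = t.realize v := by
  obtain ⟨H, -, ht, hn, ha, ho, -⟩ := hA
  have himp (s t : (modLang ι).Term V) :
      (imp s t).realize v = (s.realize v)ᶜ ⊔ t.realize v :=
    (realize_func₂ (ℒ := modLang ι) _ _ _ _).trans ((ho _ _).trans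
      (congrArg (· ⊔ _) ((realize_func₁ (ℒ := modLang ι) _ _ _).trans (hn _))))
  have h₁ : (iff s t).realize v =
      ((s.realize v)ᶜ ⊔ t.realize v) ⊓ ((t.realize v)ᶜ ⊔ s.realize v) :=
    (realize_func₂ (ℒ := modLang ι) _ _ _ _).trans
      ((ha _ _).trans (congrArg₂ _ (himp s t) (himp t s)))
  rw [h₁, ht, inf_eq_top_iff, sup_comm, ← himp_eq, himp_eq_top_iff, sup_comm, ← himp_eq,
    himp_eq_top_iff, le_antisymm_iff]

theorem IsAlgebra.realize_mp (hA : IsAlgebra (ι := ι) A) (v : V → A)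
    (s t : (modLang ι).Term V)
    (h : s.realize v =
      FirstOrder.Language.Structure.funMap (L := modLang ι) (n := 0) ModConn.top ![])
    (h' : (imp s t).realize v =
      FirstOrder.Language.Structure.funMap (L := modLang ι) (n := 0) ModConn.top ![]) :
    t.realize v =
      FirstOrder.Language.Structure.funMap (L := modLang ι) (n := 0) ModConn.top ![] := by
  obtain ⟨H, -, ht, hn, ha, ho, -⟩ := hA
  have himp : (imp s t).realize v = (s.realize v)ᶜ ⊔ t.realize v :=
    (realize_func₂ (ℒ := modLang ι) _ _ _ _).trans ((ho _ _).trans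
      (congrArg (· ⊔ _) ((realize_func₁ (ℒ := modLang ι) _ _ _).trans (hn _))))
  rw [ht] at h h' ⊢
  rwa [himp, h, compl_top, bot_sup_eq] at h'

theorem IsAlgebra.realize_nec (hA : IsAlgebra (ι := ι) A) (v : V → A)
    (s : (modLang ι).Term V) (i : ι)
    (h : s.realize v =
      FirstOrder.Language.Structure.funMap (L := modLang ι) (n := 0) ModConn.top ![]) :
    (box i s).realize v =
      FirstOrder.Language.Structure.funMap (L := modLang ι) (n := 0) ModConn.top ![] := by
  obtain ⟨H, -, ht, hn, -, -, hd, -⟩ := hA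
  have hneg (s : (modLang ι).Term V) : (neg s).realize v = (s.realize v)ᶜ :=
    (realize_func₁ (ℒ := modLang ι) _ _ _).trans (hn _)
  have hdia : (dia i (neg s)).realize v = diaMap i ((neg s).realize v) :=
    realize_func₁ (ℒ := modLang ι) _ _ _
  rw [ht] at h ⊢
  rw [box, hneg, hdia, hneg, h, compl_top, hd, compl_bot]

end

end ModL

/-! ### Theories and algebras of a logic -/

/-- The biconditional `(a → b) ∧ (b → a)`. -/
def Kind.iff {α : Type u} :
    (k : Kind.{u}) → k.lang.Term α → k.lang.Term α → k.lang.Term α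
  | .intuitionistic => IntL.iff
  | .modal _ => ModL.iff

section Theories

variable {k : Kind.{u}} {V : Type u} {L : Set (k.lang.Term V)}

/-- A set of formulas closed under the rules of the logic `L`. -/
def IsTheory (L T : Set (k.lang.Term V)) : Prop :=
  ∀ r ∈ k.rules L, r.prem ⊆ T → r.concl ∈ T

theorem thm_mem_rules {φ : k.lang.Term V} (h : φ ∈ L) :
    pi1Rule ∅ Set.finite_empty φ ∈ k.rules L := by
  cases k
  · exact IntL.Rules.thm φ h
  · exact ModL.Rules.thm φ h

theorem bound_eq_empty_of_mem_rules {r : Pi2Rule k.lang V} (h : r ∈ k.rules L) :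
    r.bound = ∅ := by
  cases k <;> cases h <;> rfl

theorem IsTheory.intuitionistic {L T : Set (intLang.Term V)} (hL : IntL.IsLogic L)
    (hT : IsTheory (k := .intuitionistic) L T) : IntL.IsTheory T where
  ax a ha := hT _ (.thm a (hL.ipc a ha)) (Set.empty_subset _)
  mp a b h h' := hT _ (.mp a b) (Set.insert_subset h' (Set.singleton_subset_iff.2 h))

theorem IsTheory.modal {ι : Type u} {L T : Set ((modLang ι).Term V)} (hL : ModL.IsLogic L)
    (hT : IsTheory (k := .modal ι) L T) : ModL.IsTheory T where
  taut a ha := hT _ (.thm a (hL.taut a ha)) (Set.empty_subset _)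
  normal i a b := hT _ (.thm _ (hL.normal i a b)) (Set.empty_subset _)
  dual i a := hT _ (.thm _ (hL.dual i a)) (Set.empty_subset _)
  mp a b h h' := hT _ (.mp a b) (Set.insert_subset h' (Set.singleton_subset_iff.2 h))
  nec i a h := hT _ (.nec i a) (Set.singleton_subset_iff.2 h)

theorem IsTheory.iff_refl (hL : k.IsLogic L) {T : Set (k.lang.Term V)} (hT : IsTheory L T)
    (a : k.lang.Term V) : k.iff a a ∈ T := by
  cases k
  · have h := IsTheory.intuitionistic hL hT
    exact h.iff_mem.2 ⟨h.refl a, h.refl a⟩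
  · have h := IsTheory.modal hL hT
    exact h.iff_mem.2 ⟨h.refl a, h.refl a⟩

theorem IsTheory.iff_symm (hL : k.IsLogic L) {T : Set (k.lang.Term V)} (hT : IsTheory L T)
    {a b : k.lang.Term V} (hab : k.iff a b ∈ T) : k.iff b a ∈ T := by
  cases k
  · have h := IsTheory.intuitionistic hL hT
    exact h.iff_mem.2 (h.iff_mem.1 hab).symm
  · have h := IsTheory.modal hL hT
    exact h.iff_mem.2 (h.iff_mem.1 hab).symm

theorem IsTheory.iff_trans (hL : k.IsLogic L) {T : Set (k.lang.Term V)} (hT : IsTheory L T)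
    {a b c : k.lang.Term V} (hab : k.iff a b ∈ T) (hbc : k.iff b c ∈ T) : k.iff a c ∈ T := by
  cases k
  · have h := IsTheory.intuitionistic hL hT
    exact h.iff_mem.2 ⟨h.trans (h.iff_mem.1 hab).1 (h.iff_mem.1 hbc).1,
      h.trans (h.iff_mem.1 hbc).2 (h.iff_mem.1 hab).2⟩
  · have h := IsTheory.modal hL hT
    exact h.iff_mem.2 ⟨h.trans (h.iff_mem.1 hab).1 (h.iff_mem.1 hbc).1,
      h.trans (h.iff_mem.1 hbc).2 (h.iff_mem.1 hab).2⟩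

theorem IsTheory.iff_func (hL : k.IsLogic L) {T : Set (k.lang.Term V)} (hT : IsTheory L T)
    {n : ℕ} (f : k.lang.Functions n) (x y : Fin n → k.lang.Term V)
    (h : ∀ i, k.iff (x i) (y i) ∈ T) : k.iff (.func f x) (.func f y) ∈ T := by
  cases k
  · exact (IsTheory.intuitionistic hL hT).iff_func f x y h
  · exact (IsTheory.modal hL hT).iff_func f x y h

theorem IsTheory.iff_one_mem (hL : k.IsLogic L) {T : Set (k.lang.Term V)} (hT : IsTheory L T)
    (a : k.lang.Term V) : k.iff a k.one.term ∈ T ↔ a ∈ T := by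
  cases k
  · have h := IsTheory.intuitionistic hL hT
    have h₁ : (Kind.one .intuitionistic).term = (IntL.top : intLang.Term V) :=
      congrArg (FirstOrder.Language.Term.func (L := intLang) (l := 0) IntConn.top)
        (Subsingleton.elim _ _)
    rw [h₁]
    exact h.iff_mem.trans ⟨fun h' => h.mem_iff_top_imp.1 h'.2,
      fun h' => ⟨h.le_top, h.mem_iff_top_imp.2 h'⟩⟩
  · rename_i ι
    have h := IsTheory.modal hL hT
    have h₁ : (Kind.one (.modal ι)).term = (ModL.top : (modLang ι).Term V) :=
      congrArg (FirstOrder.Language.Term.func (L := modLang ι) (l := 0) ModConn.top)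
        (Subsingleton.elim _ _)
    rw [h₁]
    exact h.iff_mem.trans ⟨fun h' => h.mem_iff_top_imp.1 h'.2,
      fun h' => ⟨h.le_top, h.mem_iff_top_imp.2 h'⟩⟩

/-- The Lindenbaum–Tarski algebra of a theory. -/
theorem exists_lindenbaum_algebra (hL : k.IsLogic L) {T : Set (k.lang.Term V)}
    (hT : IsTheory L T) :
    ∃ (A : Type u) (_ : k.lang.Structure A) (mk : k.lang.Term V → A), Function.Surjective mk ∧
      (∀ (φ : k.lang.Term V) (σ : V → k.lang.Term V),
        φ.realize (fun p => mk (σ p)) = mk (φ.subst σ)) ∧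
      (∀ φ χ, mk φ = mk χ ↔ k.iff φ χ ∈ T) ∧ (∀ φ, mk φ = (k.one : A) ↔ φ ∈ T) := by
  have hrel := kind_relations_isEmpty k
  let s : Setoid (k.lang.Term V) :=
    ⟨fun a b => k.iff a b ∈ T, hT.iff_refl hL, hT.iff_symm hL, hT.iff_trans hL⟩
  let ps : k.lang.Prestructure s :=
    { toStructure := { funMap := fun f x => .func f x, RelMap := fun R => isEmptyElim R }
      fun_equiv := fun {_ f} x y h => hT.iff_func hL f x y h
      rel_equiv := fun {_ R} => isEmptyElim R }
  -- Valuations in the quotient are substitutions followed by the quotient map.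
  have hreal (φ : k.lang.Term V) (σ : V → k.lang.Term V) :
      φ.realize (fun p => (Quotient.mk s (σ p))) = Quotient.mk s (φ.subst σ) := by
    rw [FirstOrder.Language.Term.realize_quotient_mk']
    congr 1
    induction φ with
    | var => rfl
    | func f ts ih =>
      simp only [FirstOrder.Language.Term.realize, FirstOrder.Language.Term.subst, ih]
      rfl
  have hmk (φ χ : k.lang.Term V) : Quotient.mk s φ = Quotient.mk s χ ↔ k.iff φ χ ∈ T :=
    Quotient.eq
  refine ⟨Quotient s, inferInstance, Quotient.mk s, Quotient.mk_surjective, hreal, hmk,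
    fun φ => ?_⟩
  have hone : (k.one : Quotient s) = Quotient.mk s k.one.term := by
    rw [← realize_one_term fun p : V => Quotient.mk s (.var p), hreal, subst_var]
  rw [hone, hmk, hT.iff_one_mem hL]

/-! ### Algebras of the logic: equations as formulas, soundness of the rules, products and
ultraproducts. -/

theorem one_eq_intuitionistic {A : Type u} [str : (Kind.lang .intuitionistic).Structure A] :
    (Kind.one .intuitionistic : A) =
      @FirstOrder.Language.Structure.funMap intLang A str 0 IntConn.top ![] :=
  congrArg (@FirstOrder.Language.Structure.funMap intLang A str 0 IntConn.top)
    (Subsingleton.elim _ _)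

theorem one_eq_modal {ι A : Type u} [str : (Kind.lang (.modal ι)).Structure A] :
    (Kind.one (.modal ι) : A) =
      @FirstOrder.Language.Structure.funMap (modLang ι) A str 0 ModConn.top ![] :=
  congrArg (@FirstOrder.Language.Structure.funMap (modLang ι) A str 0 ModConn.top)
    (Subsingleton.elim _ _)

theorem realize_iff_eq_one {A : Type u} [str : k.lang.Structure A] (hA : k.IsAlgebra A str)
    {α : Type u} (v : α → A) (s t : k.lang.Term α) :
    (k.iff s t).realize v = (k.one : A) ↔ s.realize v = t.realize v := by
  cases k
  · rw [one_eq_intuitionistic]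
    exact @IntL.IsAlgebra.realize_iff_eq_top _ _ str hA v s t
  · rw [one_eq_modal]
    exact @ModL.IsAlgebra.realize_iff_eq_top _ _ _ str hA v s t

theorem isTheory_trueAt {A : Type u} [str : k.lang.Structure A] (hA : k.IsAlgebra A str)
    (hL : ∀ φ ∈ L, ∀ v : V → A, TrueAt v φ) (v : V → A) : IsTheory L {φ | TrueAt v φ} := by
  intro r hr hv
  cases k
  · cases hr with
    | thm a ha => exact hL a ha v
    | mp a b =>
      exact (@IntL.IsAlgebra.realize_mp _ _ str hA v a b
        ((hv (.inl rfl)).trans one_eq_intuitionistic)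
        ((hv (.inr rfl)).trans one_eq_intuitionistic)).trans one_eq_intuitionistic.symm
  · cases hr with
    | thm a ha => exact hL a ha v
    | mp a b =>
      exact (@ModL.IsAlgebra.realize_mp _ _ _ str hA v a b ((hv (.inl rfl)).trans one_eq_modal)
        ((hv (.inr rfl)).trans one_eq_modal)).trans one_eq_modal.symm
    | nec i a =>
      exact (@ModL.IsAlgebra.realize_nec _ _ _ str hA v a i
        ((hv rfl).trans one_eq_modal)).trans one_eq_modal.symm

/-- Ensures that `pi2 K` extends the logic for every class `K`, and that products and ultraproducts
of algebras of the logic are again such algebras. -/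
theorem LAlgebra.validates_rules (A : LAlgebra L) {r : Pi2Rule k.lang V} (hr : r ∈ k.rules L) :
    Validates A.carrier r :=
  fun v hv => isTheory_trueAt A.isAlgebra A.models v r hr
    fun φ hφ => hv φ hφ v fun _ _ => rfl

/-- A structure that validates the rules of the logic, and in which equivalent elements are equal,
is an algebra of the logic. -/
def LAlgebra.ofValidates [Infinite V] (hL : k.IsLogic L) (A : Type u) [str : k.lang.Structure A]
    (hR : ∀ r ∈ k.rules L, Validates A r)
    (hE : ∀ (v : V → A) (p q : V), TrueAt v (k.iff (.var p) (.var q)) → v p = v q) :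
    LAlgebra L where
  carrier := A
  isAlgebra := by
    have hT (v : V → A) : IsTheory L {φ | TrueAt v φ} := by
      intro r hr h
      refine hR r hr v fun φ hφ v' hv' => ?_
      rw [bound_eq_empty_of_mem_rules hr] at hv'
      rw [funext fun p => hv' p (Set.notMem_empty p)]
      exact h hφ
    cases k
    · exact @IntL.isAlgebra_of_isTheory _ _ _ str _ one_eq_intuitionistic
        (fun v => IsTheory.intuitionistic hL (hT v)) hE
    · exact @ModL.isAlgebra_of_isTheory _ _ _ _ str _ one_eq_modal
        (fun v => IsTheory.modal hL (hT v)) hE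
  models φ hφ v := hR _ (thm_mem_rules hφ) v fun _ h => h.elim

/-- The direct product of algebras of a logic. -/
def LAlgebra.pi [Infinite V] (hL : k.IsLogic L) {I : Type u} (B : I → LAlgebra L) : LAlgebra L :=
  LAlgebra.ofValidates hL (∀ i, (B i).carrier)
    (fun _ hr => Validates.pi fun i => (B i).validates_rules hr) fun v p q h => by
      funext i
      refine (realize_iff_eq_one (B i).isAlgebra (fun x => v x i) (.var p) (.var q)).1 ?_
      have := congrFun h i
      rw [realize_pi] at this
      rw [this, ← realize_one_term v, realize_pi, realize_one_term]

/-- The ultraproduct of algebras of a logic. -/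
def LAlgebra.ultraproduct [Infinite V] (hL : k.IsLogic L) {I : Type u} (U : Ultrafilter I)
    (B : I → LAlgebra L) : LAlgebra L :=
  LAlgebra.ofValidates hL ((U : Filter I).Product fun i => (B i).carrier)
    (fun _ hr => Validates.ultraproduct fun i => (B i).validates_rules hr) fun v p q h => by
      obtain ⟨v, rfl⟩ := exists_rep v
      rw [ultraproduct_trueAt_iff] at h
      refine (ultraproduct_realize_eq_iff (ℒ := k.lang) (.var p) (.var q) v).2 ?_
      filter_upwards [h] with i hi
      exact (realize_iff_eq_one (B i).isAlgebra _ _ _).1 hi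

end Theories

/-! ### Completeness -/

section Completeness

variable {k : Kind.{u}} {V : Type u}

theorem subst_func₁ {ℒ : FirstOrder.Language.{u, 0}} (f : ℒ.Functions 1) (s : ℒ.Term V)
    (σ : V → ℒ.Term V) :
    (FirstOrder.Language.Term.func f ![s]).subst σ = .func f ![s.subst σ] := by
  simp only [FirstOrder.Language.Term.subst]
  congr 1
  funext i
  fin_cases i
  rfl

theorem subst_func₂ {ℒ : FirstOrder.Language.{u, 0}} (f : ℒ.Functions 2) (s t : ℒ.Term V)
    (σ : V → ℒ.Term V) :
    (FirstOrder.Language.Term.func f ![s, t]).subst σ = .func f ![s.subst σ, t.subst σ] := by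
  simp only [FirstOrder.Language.Term.subst]
  congr 1
  funext i
  fin_cases i <;> rfl

theorem subst_iff (s t : k.lang.Term V) (σ : V → k.lang.Term V) :
    (k.iff s t).subst σ = k.iff (s.subst σ) (t.subst σ) := by
  cases k with
  | intuitionistic =>
    exact (subst_func₂ (ℒ := intLang) _ _ _ _).trans (congrArg₂ IntL.and
      (subst_func₂ (ℒ := intLang) _ _ _ _) (subst_func₂ (ℒ := intLang) _ _ _ _))
  | modal ι =>
    have himp (s t : (modLang ι).Term V) (σ : V → (modLang ι).Term V) :
        (ModL.imp s t).subst σ = ModL.imp (s.subst σ) (t.subst σ) :=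
      (subst_func₂ (ℒ := modLang ι) _ _ _ _).trans
        (congrArg (ModL.or · _) (subst_func₁ (ℒ := modLang ι) _ _ _))
    exact (subst_func₂ (ℒ := modLang ι) _ _ _ _).trans
      (congrArg₂ ModL.and (himp _ _ _) (himp _ _ _))

theorem vars_one_term : vars (k.one.term : k.lang.Term V) = ∅ :=
  Set.eq_empty_of_forall_notMem fun _ hp => (mem_vars_func.1 hp).choose.elim0

open Classical in
/-- The substitution that replaces the variables of `P` by `1`. -/
noncomputable def eraseVars (P : Set V) (p : V) : k.lang.Term V :=
  if p ∈ P then k.one.term else .var p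

theorem eraseVars_of_notMem {P : Set V} {p : V} (hp : p ∉ P) :
    eraseVars (k := k) P p = .var p :=
  if_neg hp

/-- The constant `1` has no variables, so an erased formula is a legitimate conclusion of a rule
with bound variables `P`. -/
theorem disjoint_vars_subst_eraseVars (P : Set V) (φ : k.lang.Term V) :
    Disjoint P (vars (φ.subst (eraseVars P))) := by
  refine Set.disjoint_left.2 fun q hq hq' => ?_
  obtain ⟨p, -, hp⟩ := mem_vars_subst.1 hq'
  by_cases h : p ∈ P
  · rw [eraseVars, if_pos h, vars_one_term] at hp
    exact hp
  · rw [eraseVars, if_neg h, vars_var] at hp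
    exact h (hp ▸ hq)

theorem subst_eraseVars_eq_self {P : Set V} {φ : k.lang.Term V} (h : Disjoint P (vars φ)) :
    φ.subst (eraseVars P) = φ :=
  subst_eq_self fun _ hp => eraseVars_of_notMem (Set.disjoint_right.1 h hp)

/-- The formulas that are derivable in `S` from the premises of `r`, after the bound variables of
`r` have been replaced by `1`. -/
def derivedTheory (S : Set (Pi2Rule k.lang V)) (r : Pi2Rule k.lang V) : Set (k.lang.Term V) :=
  {φ | ∃ g ∈ S, g.prem = r.prem ∧ g.bound = r.bound ∧ g.concl = φ.subst (eraseVars r.bound)}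

variable {S : Set (Pi2Rule k.lang V)}

/-- Erasure leaves `r.concl` unchanged, as it contains no bound variable; membership would therefore
put `r` itself into `S`. -/
theorem concl_notMem_derivedTheory {r : Pi2Rule k.lang V} (hr : r ∉ S) :
    r.concl ∉ derivedTheory S r := by
  rintro ⟨g, hg, h₁, h₂, h₃⟩
  rw [subst_eraseVars_eq_self r.bound_concl] at h₃
  exact hr (Pi2Rule.ext h₁ h₃ h₂ ▸ hg)

/-- Strong reflexivity for `σ` followed by erasure: the formulas put for the bound variables then
contain none of these. -/
theorem prem_subst_mem_derivedTheory (hS : IsPi2RuleSystem S) (r : Pi2Rule k.lang V)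
    {φ : k.lang.Term V} (hφ : φ ∈ r.prem) {σ : V → k.lang.Term V}
    (hσ : ∀ p ∉ r.bound, σ p = .var p) : φ.subst σ ∈ derivedTheory S r := by
  refine ⟨⟨r.prem, (φ.subst σ).subst (eraseVars r.bound), r.bound, r.prem_finite, r.bound_finite,
    disjoint_vars_subst_eraseVars _ _⟩, ?_, rfl, rfl, rfl⟩
  refine hS.strong_reflexivity _ φ (fun p => (σ p).subst (eraseVars r.bound)) hφ
    (fun p hp => ?_) (fun p _ => disjoint_vars_subst_eraseVars _ _) (subst_subst _ _ _)
  rw [hσ p hp]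
  exact eraseVars_of_notMem hp

/-- The theory derived from a rule is closed under the rules of the rule system, the bound
variables ranging over all formulas. -/
theorem concl_subst_mem_derivedTheory [Infinite V] (hS : IsPi2RuleSystem S) (r : Pi2Rule k.lang V)
    {d : Pi2Rule k.lang V} (hd : d ∈ S) (σ : V → k.lang.Term V)
    (h : ∀ φ ∈ d.prem, ∀ τ : V → k.lang.Term V, (∀ p ∉ d.bound, τ p = σ p) →
      φ.subst τ ∈ derivedTheory S r) :
    d.concl.subst σ ∈ derivedTheory S r := by
  classical
  let σ₁ : V → k.lang.Term V := fun p => (σ p).subst (eraseVars r.bound)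
  let D : Set V := varsOf d.prem ∪ vars d.concl
  have hD : D.Finite := (finite_varsOf d.prem_finite).union (finite_vars _)
  -- Everything the new bound variables must avoid: the variables of `d`, those of the premises and
  -- the bound variables of `r`, and those that `σ₁` introduces.
  let X : Set V := D ∪ varsOf r.prem ∪ r.bound ∪ ⋃ p ∈ D, vars (σ₁ p)
  have hX : X.Finite := ((hD.union (finite_varsOf r.prem_finite)).union r.bound_finite).union
    (hD.biUnion fun p _ => finite_vars _)
  obtain ⟨g, hg, hgX⟩ := exists_injOn_of_infinite d.bound_finite hX
  let ρ : V → V := fun p => if p ∈ d.bound then g p else p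
  have hρ : ∀ p ∈ d.bound, ρ p = g p := fun p hp => if_pos hp
  have hρ' : ∀ p ∉ d.bound, ρ p = p := fun p hp => if_neg hp
  have hfresh : Disjoint (ρ '' d.bound) X := by
    rw [Set.disjoint_left]
    rintro _ ⟨p, hp, rfl⟩
    rw [hρ p hp]
    exact hgX p
  have hfreshD : Disjoint (ρ '' d.bound) D := hfresh.mono_right fun _ hp => .inl (.inl (.inl hp))
  have hfreshσ : ∀ p ∈ D, Disjoint (ρ '' d.bound) (vars (σ₁ p)) := fun p hp =>
    hfresh.mono_right fun _ hq => .inr (Set.mem_biUnion hp hq)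
  -- Acts as `σ₁` only on the free variables of `d`. Being the identity elsewhere, it fixes the
  -- fresh variables and never introduces them, as bound structurality requires.
  let σ' : V → k.lang.Term V := fun p => if p ∈ D \ d.bound then σ₁ p else .var p
  have hσ' : ∀ p ∈ D \ d.bound, σ' p = σ₁ p := fun p hp => if_pos hp
  have hσρ : ∀ p ∈ ρ '' d.bound, σ' p = .var p := fun p hp =>
    if_neg fun h => Set.disjoint_left.1 hfreshD hp h.1
  have hconcl : d.concl.subst σ' = (d.concl.subst σ).subst (eraseVars r.bound) := by
    rw [subst_subst]
    exact subst_congr fun p hp => hσ' p ⟨.inr hp, Set.disjoint_right.1 d.bound_concl hp⟩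
  have hfree : ∀ q ∉ ρ '' d.bound, Disjoint (ρ '' d.bound) (vars (σ' q)) := by
    intro q hq
    by_cases hqD : q ∈ D \ d.bound
    · rw [hσ' q hqD]
      exact hfreshσ q hqD.1
    · rw [show σ' q = .var q from if_neg hqD, vars_var]
      exact Set.disjoint_singleton_right.2 hq
  have hbconcl : Disjoint (ρ '' d.bound) (vars d.concl) :=
    hfreshD.mono_right Set.subset_union_right
  let d₁ : Pi2Rule k.lang V := ⟨substSet (fun p => .var (ρ p)) d.prem, d.concl, ρ '' d.bound,
    d.prem_finite.image _, d.bound_finite.image _, hbconcl⟩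
  have hd₁ : d₁ ∈ S := by
    refine hS.alpha_renaming d d₁ ρ hd ?_ hρ' ?_ hbconcl rfl rfl rfl
    · intro p hp q hq hpq
      rw [hρ p hp, hρ q hq] at hpq
      exact hg hp hq hpq
    · exact hfreshD.mono_right fun _ hp => .inl hp.1
  let d₂ : Pi2Rule k.lang V := ⟨substSet σ' d₁.prem, d₁.concl.subst σ', ρ '' d.bound,
    d₁.prem_finite.image _, d.bound_finite.image _, by
      refine Set.disjoint_left.2 fun q hq hq' => ?_
      obtain ⟨p, hp, hqp⟩ := mem_vars_subst.1 hq'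
      exact Set.disjoint_left.1 (hfree p (Set.disjoint_right.1 hbconcl hp)) hq hqp⟩
  have hd₂ : d₂ ∈ S :=
    hS.bound_structurality d₁ d₂ σ' hd₁ hσρ (fun q hq => hfree q hq.2) rfl rfl rfl
  refine ⟨⟨r.prem, (d.concl.subst σ).subst (eraseVars r.bound), r.bound, r.prem_finite,
    r.bound_finite, disjoint_vars_subst_eraseVars _ _⟩, ?_, rfl, rfl, rfl⟩
  refine hS.rule_cut d₂ _ hd₂ ?_ (hfresh.mono_right fun _ hp => .inl (.inl (.inr hp)))
    hconcl.symm
  rintro _ ⟨_, ⟨φ, hφ, rfl⟩, rfl⟩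
  -- The hypothesis is used only for the `τ` that sends bound variables to their fresh names.
  -- Erasure does not touch these, so the derived formula is exactly the premise of `d₂`.
  obtain ⟨e, he, h₁, h₂, h₃⟩ := h φ hφ (fun p => if p ∈ d.bound then .var (ρ p) else σ p)
    fun p hp => if_neg hp
  refine ⟨e, he, h₁, h₂, h₃.trans ?_⟩
  rw [subst_subst]
  refine Eq.trans (subst_congr fun p hp => ?_) (subst_subst _ _ _).symm
  by_cases hpb : p ∈ d.bound
  · simp only [if_pos hpb]
    refine (eraseVars_of_notMem fun hr => ?_).trans (hσρ (ρ p) ⟨p, hpb, rfl⟩).symm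
    exact Set.disjoint_left.1 hfresh ⟨p, hpb, rfl⟩ (.inl (.inr hr))
  · simp only [if_neg hpb]
    refine (hσ' p ⟨.inl (vars_subset_varsOf hφ hp), hpb⟩).symm.trans ?_
    rw [hρ' p hpb]
    rfl

theorem isTheory_derivedTheory [Infinite V] {L : Set (k.lang.Term V)} (hS : IsPi2RuleSystem S)
    (hLS : k.rules L ⊆ S) (r : Pi2Rule k.lang V) : IsTheory L (derivedTheory S r) := by
  intro d hd h
  rw [← subst_var d.concl]
  refine concl_subst_mem_derivedTheory hS r (hLS hd) _ fun φ hφ τ hτ => ?_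
  rw [bound_eq_empty_of_mem_rules hd] at hτ
  rw [subst_eq_self fun p _ => hτ p (Set.notMem_empty p)]
  exact h hφ

/-- Every rule outside a rule system is refuted in an algebra that validates the system. -/
theorem exists_mem_ind_not_validates [Infinite V] {L : Set (k.lang.Term V)} (hL : k.IsLogic L)
    (hS : IsPi2RuleSystem S) (hLS : k.rules L ⊆ S) {r : Pi2Rule k.lang V} (hr : r ∉ S) :
    ∃ A ∈ ind L S, ¬ Validates A.carrier r := by
  obtain ⟨A, str, mk, hsurj, hreal, hmk, hone⟩ :=
    exists_lindenbaum_algebra hL (isTheory_derivedTheory hS hLS r)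
  have htrue (σ : V → k.lang.Term V) (φ : k.lang.Term V) :
      TrueAt (fun p => mk (σ p)) φ ↔ φ.subst σ ∈ derivedTheory S r := by
    rw [TrueAt, hreal, hone]
  have hval : ∀ d ∈ S, Validates A d := by
    intro d hd v hv
    choose σ hσ using fun p => hsurj (v p)
    obtain rfl : (fun p => mk (σ p)) = v := funext hσ
    rw [htrue]
    refine concl_subst_mem_derivedTheory hS r hd σ fun φ hφ τ hτ => ?_
    exact (htrue τ φ).1 (hv φ hφ _ fun p hp => by rw [hτ p hp])
  refine ⟨LAlgebra.ofValidates hL A (fun d hd => hval d (hLS hd)) fun v p q h => ?_, hval, ?_⟩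
  · choose σ hσ using fun p => hsurj (v p)
    obtain rfl : (fun p => mk (σ p)) = v := funext hσ
    refine (hmk _ _).2 ?_
    rw [htrue] at h
    rwa [subst_iff] at h
  · intro hA
    refine concl_notMem_derivedTheory hr ?_
    rw [← subst_var r.concl, ← htrue]
    refine hA _ fun φ hφ v hv => ?_
    choose σ hσ using fun p => hsurj (v p)
    classical
    -- The refuting valuation sends each variable to its own class. A variant of it represents bound
    -- variables by arbitrary formulas, which strong reflexivity covers.
    have hv' : v = fun p => mk (if p ∈ r.bound then σ p else .var p) := by
      funext p
      by_cases hp : p ∈ r.bound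
      · simp only [if_pos hp, hσ]
      · simpa only [if_neg hp] using hv p hp
    rw [hv']
    exact (htrue _ φ).2 (prem_subst_mem_derivedTheory hS r hφ fun p hp => if_neg hp)

end Completeness

/-! ### Inductive rule classes are determined by their rules -/

section Diagram

variable {k : Kind.{u}} {V : Type u} {L : Set (k.lang.Term V)}

/-- The terms `t(x̄, ā)`, with parameters `ā` from `A` and variables `x̄` among the natural numbers,
such that `A ⊨ ∀x̄ t(x̄, ā) = 1`. -/
def forallDiagram (A : Type u) [k.lang.Structure A] : Set (k.lang.Term (A ⊕ ℕ)) :=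
  {t | ∀ x : ℕ → A, t.realize (Sum.elim id x) = (k.one : A)}

/-- With elements and numbers named by variables, "if all of `Γ` holds universally, then `a = 1`" is
a `Π₂`-rule. It fails in `A`, so it is not in `pi2 K`, and a valuation refuting it in a member of
`K` yields `h`. -/
theorem exists_mem_refuting [Infinite V] {K : Set (LAlgebra L)} {A : LAlgebra L}
    (hA : A ∈ ind L (pi2 K)) {Γ : Set (k.lang.Term (A.carrier ⊕ ℕ))} (hΓ : Γ.Finite)
    (hΓA : Γ ⊆ forallDiagram A.carrier) {a : A.carrier} (ha : a ≠ (k.one : A.carrier)) :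
    ∃ B ∈ K, ∃ h : A.carrier → B.carrier,
      (∀ t ∈ Γ, ∀ x : ℕ → B.carrier, t.realize (Sum.elim h x) = (k.one : B.carrier)) ∧
      h a ≠ (k.one : B.carrier) := by
  classical
  let F : Set (A.carrier ⊕ ℕ) := insert (.inl a) (varsOf Γ)
  have hF : F.Finite := (finite_varsOf hΓ).insert _
  obtain ⟨g, hg, -⟩ := exists_injOn_of_infinite (β := V) hF Set.finite_empty
  have : Nonempty (A.carrier ⊕ ℕ) := ⟨.inr 0⟩
  let e : V → A.carrier ⊕ ℕ := Function.invFunOn g F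
  have he : ∀ p ∈ F, e (g p) = p := fun p hp => hg.leftInvOn_invFunOn hp
  -- The names of the numbers, i.e. of the universally quantified variables, become the bound
  -- variables.
  let P : Set V := g '' (F ∩ Set.range .inr)
  have hP : ∀ b, .inl b ∈ F → g (.inl b) ∉ P := by
    rintro b hb ⟨_, ⟨hF', n, rfl⟩, hn⟩
    exact Sum.inr_ne_inl (hg hF' hb hn)
  let r : Pi2Rule k.lang V :=
    ⟨(fun t => t.relabel g) '' Γ, .var (g (.inl a)), P, hΓ.image _,
      (hF.subset Set.inter_subset_left).image _, by
        rw [vars_var]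
        exact Set.disjoint_singleton_right.2 (hP a (Set.mem_insert _ _))⟩
  have hr : ¬ Validates A.carrier r := by
    intro hval
    have h₁ : e (g (.inl a)) = .inl a := he _ (Set.mem_insert _ _)
    have h₂ := hval (fun y => Sum.elim id (fun _ => (k.one : A.carrier)) (e y)) ?_
    · refine ha (Eq.trans ?_ h₂)
      change a = Sum.elim id _ (e (g (.inl a)))
      rw [h₁]
      rfl
    · rintro _ ⟨t, ht, rfl⟩ v hv
      refine Eq.trans ?_ (hΓA ht fun n => v (g (.inr n)))
      refine FirstOrder.Language.Term.realize_relabel.trans (realize_congr ?_)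
      rintro (b | n) hp
      · have hb : .inl b ∈ F := .inr (vars_subset_varsOf ht hp)
        simp only [Function.comp_apply, Sum.elim_inl]
        rw [hv _ (hP b hb), he _ hb]
        rfl
      · rfl
  have hr' : r ∉ pi2 K := fun h => hr (hA r h)
  simp only [pi2, Set.mem_ofPred_eq, not_forall] at hr'
  obtain ⟨B, hB, hBr⟩ := hr'
  unfold Validates at hBr
  push Not at hBr
  obtain ⟨v, hv, hvc⟩ := hBr
  -- Only the values at elements in `F` matter; `h` is arbitrary at the others.
  refine ⟨B, hB, fun b => v (g (.inl b)), fun t ht x => ?_, hvc⟩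
  refine Eq.trans ?_ (hv _ ⟨t, ht, rfl⟩
    (fun y => if y ∈ P then Sum.elim (fun _ => (k.one : B.carrier)) x (e y) else v y)
    fun p hp => if_neg hp)
  refine (realize_congr ?_).trans FirstOrder.Language.Term.realize_relabel.symm
  rintro (b | n) hp
  · have hb : .inl b ∈ F := .inr (vars_subset_varsOf ht hp)
    simp only [Function.comp_apply, Sum.elim_inl, if_neg (hP b hb)]
  · have hn : .inr n ∈ F := .inr (vars_subset_varsOf ht hp)
    have hn' : g (.inr n) ∈ P := ⟨_, ⟨hn, n, rfl⟩, rfl⟩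
    simp only [Function.comp_apply, Sum.elim_inr, if_pos hn', he _ hn]

/-- The product, over all `a ≠ 1`, of algebras refuting `a`: equations hold coordinatewise and every
`a ≠ 1` is detected in its own coordinate. For a trivial `A` this is the empty product. -/
theorem exists_mem_separating [Infinite V] (hL : k.IsLogic L) {K : Set (LAlgebra L)}
    (hK : IsInductiveRuleClass K) {A : LAlgebra L} (hA : A ∈ ind L (pi2 K))
    {Γ : Set (k.lang.Term (A.carrier ⊕ ℕ))} (hΓ : Γ.Finite) (hΓA : Γ ⊆ forallDiagram A.carrier) :
    ∃ B ∈ K, ∃ h : A.carrier → B.carrier,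
      (∀ t ∈ Γ, ∀ x : ℕ → B.carrier, t.realize (Sum.elim h x) = (k.one : B.carrier)) ∧
      ∀ a, h a = (k.one : B.carrier) → a = (k.one : A.carrier) := by
  choose B hB h hΓB ha using fun a : {a : A.carrier // a ≠ (k.one : A.carrier)} =>
    exists_mem_refuting hA hΓ hΓA a.2
  have hone (a) : (k.one : ∀ a, (B a).carrier) a = (k.one : (B a).carrier) := by
    rw [← realize_one_term (fun p : V => (k.one : ∀ a, (B a).carrier)), realize_pi,
      realize_one_term]
  have h₁ : ∀ t ∈ Γ, ∀ x : ℕ → ∀ a, (B a).carrier,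
      t.realize (Sum.elim (fun b a => h a b) x) = (k.one : ∀ a, (B a).carrier) := by
    intro t ht x
    funext a
    rw [realize_pi, hone, ← hΓB a t ht fun n => x n a]
    congr 1
    funext p
    cases p <;> rfl
  have h₂ (b : A.carrier) (hb : (fun a => h a b) = (k.one : ∀ a, (B a).carrier)) :
      b = (k.one : A.carrier) := by
    by_contra hne
    exact ha ⟨b, hne⟩ ((congrFun hb ⟨b, hne⟩).trans (hone _))
  exact ⟨LAlgebra.pi hL B,
    hK.prod _ B _ hB ⟨FirstOrder.Language.Equiv.refl k.lang (∀ a, (B a).carrier)⟩,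
    fun b a => h a b, h₁, h₂⟩

/-- A map between algebras that preserves the universal equations with parameters and reflects `1`
is a `∀`-embedding. -/
theorem exists_isForallEmbedding {A B : Type u} [strA : k.lang.Structure A]
    [strB : k.lang.Structure B] (hA : k.IsAlgebra A strA) (hB : k.IsAlgebra B strB) (h : A → B)
    (hdiag : ∀ t ∈ forallDiagram (k := k) A, ∀ x : ℕ → B,
      t.realize (Sum.elim h x) = (k.one : B))
    (hone : ∀ a, h a = (k.one : B) → a = (k.one : A)) :
    ∃ f : A ↪[k.lang] B, IsForallEmbedding f := by
  have hrel := kind_relations_isEmpty k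
  have heq (s t : k.lang.Term (A ⊕ ℕ))
      (hst : ∀ x : ℕ → A, s.realize (Sum.elim id x) = t.realize (Sum.elim id x)) (x : ℕ → B) :
      s.realize (Sum.elim h x) = t.realize (Sum.elim h x) :=
    (realize_iff_eq_one hB _ s t).1
      (hdiag _ (fun y => (realize_iff_eq_one hA _ s t).2 (hst y)) x)
  have hinj : Function.Injective h := by
    intro a b hab
    -- Let `c` be the value of `a ↔ b` in `A`. The equation `(a ↔ b) = c`, with `c` as a parameter,
    -- transfers to `B`, where `h a = h b` makes the left side `1`. So `h c = 1`, hence `c = 1` and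
    -- `a = b`.
    let s : k.lang.Term A := k.iff (.var a) (.var b)
    have h₁ := heq (s.relabel .inl) (.var (.inl (s.realize id)))
      (fun _ => FirstOrder.Language.Term.realize_relabel) fun _ => (k.one : B)
    rw [FirstOrder.Language.Term.realize_relabel,
      (realize_iff_eq_one hB _ _ _).2 (by exact hab)] at h₁
    exact (realize_iff_eq_one hA id _ _).1 (hone _ h₁.symm)
  let f : A ↪[k.lang] B :=
    { toFun := h
      inj' := hinj
      map_fun' := fun f x => (heq (.func f fun i => .var (.inl (x i)))
        (.var (.inl (FirstOrder.Language.Structure.funMap f x))) (fun _ => rfl)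
        fun _ => (k.one : B)).symm
      map_rel' := fun R => isEmptyElim R }
  refine ⟨f, fun m n φ hφ a ha x => ?_⟩
  cases hφ with
  | rel R => exact isEmptyElim R
  | equal s t =>
    let g : (Fin m ⊕ Fin n) ⊕ Fin 0 → A ⊕ ℕ :=
      Sum.elim (Sum.elim (fun i => .inr i) fun j => .inl (a j)) Fin.elim0
    have h₁ := heq (s.relabel g) (t.relabel g) (fun y => ?_)
      -- Numbers from `m` on do not occur in the relabelled terms; `1` is a filler.
      fun i => if hi : i < m then x ⟨i, hi⟩ else (k.one : B)
    · rw [FirstOrder.Language.Term.realize_relabel, FirstOrder.Language.Term.realize_relabel] at h₁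
      rw [FirstOrder.Language.Formula.Realize, FirstOrder.Language.BoundedFormula.realize_bdEqual]
      convert h₁ using 2 <;>
      · funext p
        rcases p with (i | j) | l
        · simp [g]
        · rfl
        · exact l.elim0
    · have h₂ := ha fun i => y i
      rw [FirstOrder.Language.Formula.Realize,
        FirstOrder.Language.BoundedFormula.realize_bdEqual] at h₂
      rw [FirstOrder.Language.Term.realize_relabel, FirstOrder.Language.Term.realize_relabel]
      convert h₂ using 2 <;>
      · funext p
        rcases p with (i | j) | l
        · rfl
        · rfl
        · exact l.elim0

/-- Compactness by an ultraproduct: each finite part of the universal diagram of `A` is realized in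
a member of `K` with `1` reflected, and an ultraproduct of these realizes the whole diagram. -/
theorem ind_pi2_subset [Infinite V] (hL : k.IsLogic L) {K : Set (LAlgebra L)}
    (hK : IsInductiveRuleClass K) : ind L (pi2 K) ⊆ K := by
  classical
  intro A hA
  let I : Type u := Finset (forallDiagram (k := k) A.carrier)
  have hex (Γ : I) := exists_mem_separating hL hK hA
    (Γ := Subtype.val '' (Γ : Set (forallDiagram (k := k) A.carrier)))
    (Γ.finite_toSet.image _) (by rintro _ ⟨t, -, rfl⟩; exact t.2)
  choose B hB h hΓB hone using hex
  -- Refining `atTop` on finite sets, `U` makes each formula of the diagram belong to almost every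
  -- index.
  let U : Ultrafilter I := Ultrafilter.of Filter.atTop
  let H : A.carrier → (U : Filter I).Product fun i => (B i).carrier :=
    fun a => ultraMk U fun i => h i a
  have hdiag : ∀ t ∈ forallDiagram (k := k) A.carrier,
      ∀ x : ℕ → (U : Filter I).Product fun i => (B i).carrier,
      t.realize (Sum.elim H x) = (k.one : (U : Filter I).Product fun i => (B i).carrier) := by
    intro t ht x
    obtain ⟨x, rfl⟩ := exists_rep x
    have h₁ := (ultraproduct_realize_eq_iff (U := U) t k.one.term
      (Sum.elim (fun a i => h i a) x)).2 ?_
    · rw [realize_one_term] at h₁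
      rw [← h₁]
      congr 1
      funext p
      cases p <;> rfl
    · filter_upwards [Ultrafilter.of_le (f := Filter.atTop)
        (Filter.eventually_ge_atTop ({⟨t, ht⟩} : I))] with i hi
      rw [realize_one_term, ← hΓB i t ⟨⟨t, ht⟩, hi (Finset.mem_singleton_self _), rfl⟩
        fun n => x n i]
      congr 1
      funext p
      cases p <;> rfl
  have hH : ∀ a, H a = (k.one : (U : Filter I).Product fun i => (B i).carrier) →
      a = (k.one : A.carrier) := by
    intro a ha
    have h₁ := (ultraproduct_realize_eq_iff (ℒ := k.lang) (U := U) (.var ()) k.one.term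
      (fun _ i => h i a)).1 (by rw [realize_one_term]; exact ha)
    -- A single index suffices, since every `h i` reflects `1`.
    obtain ⟨i, hi⟩ := h₁.exists
    rw [realize_one_term] at hi
    exact hone i a hi
  obtain ⟨f, hf⟩ := exists_isForallEmbedding A.isAlgebra
    (LAlgebra.ultraproduct hL U B).isAlgebra H hdiag hH
  exact hK.forall_sub A (LAlgebra.ultraproduct hL U B) f hf (hK.ultraprod I U B _ hB
    ⟨FirstOrder.Language.Equiv.refl k.lang ((U : Filter I).Product fun i => (B i).carrier)⟩)

end Diagram

end PiTwo

/-! ### The dual isomorphism. -/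

theorem mainTheorem1 {k : PiTwo.Kind.{u}} {V : Type u} [Infinite V]
    (L : Set (k.lang.Term V)) (hL : k.IsLogic L) :
    ∃ e : PiTwo.RuleSystem L ≃o (PiTwo.InductiveRuleClass L)ᵒᵈ,
      (∀ S : PiTwo.RuleSystem L, (OrderDual.ofDual (e S)).1 = PiTwo.ind L S.1) ∧
      (∀ K : PiTwo.InductiveRuleClass L,
        (e.symm (OrderDual.toDual K)).1 = PiTwo.pi2 K.1) ∧
      (∀ S T : PiTwo.RuleSystem L,
        PiTwo.ind L (S.1 ∩ T.1) =
          PiTwo.inductiveClosure (PiTwo.ind L S.1 ∪ PiTwo.ind L T.1)) ∧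
      (∀ S T : PiTwo.RuleSystem L,
        PiTwo.ind L (PiTwo.ruleClosure (S.1 ∪ T.1)) =
          PiTwo.ind L S.1 ∩ PiTwo.ind L T.1) := by
  have hpi2 (S : PiTwo.RuleSystem L) : PiTwo.pi2 (PiTwo.ind L S.1) = S.1 := by
    refine Set.Subset.antisymm (fun r hr => ?_) fun r hr A hA => hA r hr
    by_contra hrS
    obtain ⟨A, hA, hAr⟩ := PiTwo.exists_mem_ind_not_validates hL S.2.1 S.2.2 hrS
    exact hAr (hr A hA)
  have hind (K : PiTwo.InductiveRuleClass L) : PiTwo.ind L (PiTwo.pi2 K.1) = K.1 :=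
    Set.Subset.antisymm (PiTwo.ind_pi2_subset hL K.2) fun A hA r hr => hr A hA
  let e : PiTwo.RuleSystem L ≃o (PiTwo.InductiveRuleClass L)ᵒᵈ :=
    { toFun := fun S => OrderDual.toDual ⟨PiTwo.ind L S.1, PiTwo.isInductiveRuleClass_ind L S.1⟩
      invFun := fun K => ⟨PiTwo.pi2 (OrderDual.ofDual K).1, PiTwo.isPi2RuleSystem_pi2 _,
        fun _ hr A _ => A.validates_rules hr⟩
      left_inv := fun S => Subtype.ext (hpi2 S)
      right_inv := fun K => Subtype.ext (hind (OrderDual.ofDual K))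
      map_rel_iff' := by
        intro S T
        constructor
        · intro h
          change S.1 ⊆ T.1
          rw [← hpi2 S, ← hpi2 T]
          exact fun r hr A hA => hr A (h hA)
        · exact fun h A hA r hr => hA r (h hr) }
  refine ⟨e, fun _ => rfl, fun _ => rfl, fun S T => ?_, fun S T => ?_⟩
  -- An order isomorphism preserves meets, and a meet in the order dual is a join of classes.
  · exact congrArg (fun K => (OrderDual.ofDual K).1) (e.map_inf S T)
  · exact congrArg (fun K => (OrderDual.ofDual K).1) (e.map_sup S T)
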